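/- Let $G=(V,E)$ be a finite, simple, undirected, connected graph with $n=|V|$ vertices and edge weights $w\colon E\to\mathbb{R}_{\ge 0}$. An agent starts at a vertex $s$, knows of $G$ only the vertices it has visited (the *explored* vertices), their neighbours and the edges at explored vertices with their weights, pays $w(e)$ for each traversal of an edge $e$, and has to visit all vertices and return to $s$. A *boundary edge* $(u,v)$ is an edge with $u$ explored and $v$ unexplored; $d(x,y)$ denotes the current length of a shortest path from $x$ to $y$ all of whose internal vertices are explored. For $\delta\ge 0$, a boundary edge $e=(u,v)$ is *$\delta$-blocked* by a boundary edge $e'=(u',v')$ if $w(e')<w(e)$ and $d(u,v')\le(1+\delta)\,w(e)$; it is $\delta$-blocked if some boundary edge blocks it. The algorithm $\textsc{Blocking}_\delta$ is the recursive procedure, first called on $s$, whose call on $v$ is: while there is a boundary edge $e=(y,x)$ that is not $\delta$-blocked and such that $y=v$ or $e$ was at an earlier time $\delta$-blocked by some edge $(u,v)$, traverse a shortest internally explored path from $v$ to $y$, traverse $e$, call $\textsc{Blocking}_\delta$ on $x$, and traverse a shortest internally explored path from $x$ to $v$. (Ties may be broken arbitrarily.) Let $\textsc{Opt}(G)$ be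 the minimum length of a closed walk in $G$ that visits all vertices. Theorem. $\textsc{Blocking}_{\log n}$ is $O(\log n)$-competitive: there is an absolute constant $C$ such that, for every such weighted graph $G$ with $n$ vertices, every start vertex $s$ and every way of breaking ties, $\textsc{Blocking}_{\log n}$ terminates after visiting all vertices and returning to $s$, at a total cost of at most $C\log (n)\cdot \textsc{Opt}(G)$. -/

import Mathlib

open scoped NNReal ENNReal

noncomputable section

namespace OnlineExploration

variable {V : Type*} {G : SimpleGraph V}

/-- The length of a walk: the sum of the weights of the edges it traverses, with multiplicity. -/
def walkWeight (w : Sym2 V → ℝ≥0) {x y : V} (p : G.Walk x y) : ℝ≥0 :=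
  (p.edges.map w).sum

/-- The cost of an optimal offline exploration tour, that is, the smallest length of a closed
walk that visits all vertices (from an arbitrary start vertex). -/
def opt (G : SimpleGraph V) (w : Sym2 V → ℝ≥0) : ℝ≥0 :=
  sInf {c | ∃ (s : V) (W : G.Walk s s), (∀ x, x ∈ W.support) ∧ c = walkWeight w W}

/-! In what follows, the list `h` (a *history*) holds the explored vertices, the most recently
explored one first. The set of explored vertices only changes when a vertex is added to the
history, so the earlier stages of the exploration are exactly the suffixes of `h`. -/

/-- `(u, v)` is a boundary edge, with explored endpoint `u` and unexplored endpoint `v`. -/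
def IsBoundary (G : SimpleGraph V) (h : List V) (u v : V) : Prop :=
  G.Adj u v ∧ u ∈ h ∧ v ∉ h

/-- The walk `p` is a path all of whose internal vertices are explored. -/
def IsInternallyExplored (h : List V) {x y : V} (p : G.Walk x y) : Prop :=
  p.IsPath ∧ ∀ z ∈ p.support, z ≠ x → z ≠ y → z ∈ h

/-- The length `d(x, y)` of a shortest internally explored path linking `x` and `y`
(`∞` if there is none). -/
def exploredDist (G : SimpleGraph V) (w : Sym2 V → ℝ≥0) (h : List V) (x y : V) : ℝ≥0∞ :=
  ⨅ p : {p : G.Walk x y // IsInternallyExplored h p}, (walkWeight w p.1 : ℝ≥0∞)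

/-- `p` is a shortest internally explored path from `x` to `y`. -/
def IsShortest (w : Sym2 V → ℝ≥0) (h : List V) {x y : V} (p : G.Walk x y) : Prop :=
  IsInternallyExplored h p ∧ (walkWeight w p : ℝ≥0∞) = exploredDist G w h x y

/-- The boundary edge `(u, v)` is `δ`-blocked by the boundary edge `(u', v')`. -/
def IsBlockedBy (G : SimpleGraph V) (w : Sym2 V → ℝ≥0) (δ : ℝ) (h : List V)
    (u v u' v' : V) : Prop :=
  IsBoundary G h u v ∧ IsBoundary G h u' v' ∧ w s(u', v') < w s(u, v) ∧
    exploredDist G w h u v' ≤ ENNReal.ofReal ((1 + δ) * w s(u, v))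

/-- The boundary edge `(u, v)` is `δ`-blocked. -/
def IsBlocked (G : SimpleGraph V) (w : Sym2 V → ℝ≥0) (δ : ℝ) (h : List V) (u v : V) : Prop :=
  ∃ u' v', IsBlockedBy G w δ h u v u' v'

/-- The condition of the while loop in the call of the algorithm on the vertex `v`, for the edge
`(y, x)`: it is a boundary edge that is not blocked and such that `y = v` or `(y, x)` was blocked
at an earlier stage by some edge `(u, v)`. (At the current stage `v` is explored, so `(u, v)` is
not a boundary edge any more.) -/
def IsEligible (G : SimpleGraph V) (w : Sym2 V → ℝ≥0) (δ : ℝ) (h : List V)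
    (v y x : V) : Prop :=
  IsBoundary G h y x ∧ ¬ IsBlocked G w δ h y x ∧
    (y = v ∨ ∃ h', h' <:+ h ∧ ∃ u, IsBlockedBy G w δ h' y x u v)

/-- A configuration of the exploration from the start vertex `s`: the history, the position of
the agent, the walk that the agent has traversed so far, and the stack of the arguments of the
open recursive calls, the innermost call first. -/
structure Config (G : SimpleGraph V) (s : V) where
  hist : List V
  pos : V
  walk : G.Walk s pos
  stack : List V

/-- The algorithm `Blocking_δ`. Ties (which eligible edge, which shortest path) may be broken
arbitrarily. -/
inductive Step (G : SimpleGraph V) (w : Sym2 V → ℝ≥0) (δ : ℝ) (s : V) :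
    Config G s → Config G s → Prop
  /-- In the call on `v`, an edge `(y, x)` satisfies the condition of the loop: traverse a shortest
  internally explored path from `v` to `y`, traverse `(y, x)`, and call the algorithm on `x`. -/
  | explore {h : List V} {v y x : V} {rest : List V} (W : G.Walk s v) (p : G.Walk v y)
      (hyx : G.Adj y x) (hel : IsEligible G w δ h v y x) (hp : IsShortest w h p) :
      Step G w δ s ⟨h, v, W, v :: rest⟩ ⟨x :: h, x, (W.append p).concat hyx, x :: v :: rest⟩
  /-- The loop in the call on `x` ends: return to the calling instance, on `v`, by traversing a
  shortest internally explored path from `x` to `v`. -/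
  | back {h : List V} {x v : V} {rest : List V} (W : G.Walk s x) (q : G.Walk x v)
      (hend : ∀ y z, ¬ IsEligible G w δ h x y z) (hq : IsShortest w h q) :
      Step G w δ s ⟨h, x, W, x :: v :: rest⟩ ⟨h, v, W.append q, v :: rest⟩

/-- The initial call of the algorithm, on the start vertex. -/
def Config.init (G : SimpleGraph V) (s : V) : Config G s :=
  ⟨[s], s, SimpleGraph.Walk.nil, [s]⟩

/-- `Blocking_δ` solves the exploration problem on the weighted graph `(G, w)` at a cost of at most
`ρ` times the offline optimum: from every start vertex and however ties are broken, it
terminates, with all vertices visited, the agent back at the start vertex, and a total cost of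
at most `ρ * opt G w`. -/
def BlockingIsCompetitive (G : SimpleGraph V) (w : Sym2 V → ℝ≥0) (δ ρ : ℝ) : Prop :=
  ∀ s : V, Acc (fun c' c => Step G w δ s c c') (Config.init G s) ∧
    ∀ c : Config G s, Relation.ReflTransGen (Step G w δ s) (Config.init G s) c →
      (∀ c', ¬ Step G w δ s c c') →
        c.pos = s ∧ (∀ x, x ∈ c.walk.support) ∧
          (walkWeight w c.walk : ℝ) ≤ ρ * (opt G w : ℝ)

end OnlineExploration

end

open scoped NNReal ENNReal

noncomputable section

namespace OnlineExploration

/-! The cost is charged to the explored edges. An edge `e` is reached over a distance of at most `(1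
+ δ) w(e)`, and the way home from it is no longer than the way out, so a run costs at most `2(2 +
δ)` times the total weight of the set `P` of explored edges (`RunInvariant.step`). It remains to
show `w(P) = O(opt)` for `δ = log n`.

Let `T` be a minimum spanning tree that prefers edges of `P` in case of ties. In `T ∪ P` each edge
of a circuit `C` has weight less than `w(C) / (2 + δ)` (`Trace.lt_walkWeight_of_isTrail`). Indeed
the heaviest edges of `C` lie in `P`. When the last explored of them was traversed, the rest of `C`
left the explored set by a lighter boundary edge, which did not block it and hence was far away.

A graph with such long circuits has weight `O(w(T))` (`LongCircuits.sum_le`). For a radius `r`, call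
an edge heavy if `2r ≤ (1 + δ) w(e)`. Within a ball of radius `r` heavy edges are bridges
(`LongCircuits.isBridge`), so together with the edges of `T` in the ball they form a forest.
Comparing this forest with `T` gives an isoperimetric inequality (`LongCircuits.sum_inf_le`): the
heavy edges carry at most as much of a function supported in the ball as its total variation on `T`.
Apply it to the uniform distributions on the balls of radius `r` around all vertices, and integrate
over `r`. The variation along an edge of weight `ω` is controlled by the growth of `log |B(x, ·)|`
from `r - ω` to `r + ω`, whose integral telescopes to at most `2ω log n`. An edge outside `T` gains
order `(1 + δ) ω` on the left, an edge of `T` pays order `(1 + log n) ω` on the right, and these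
factors cancel. -/

open SimpleGraph MeasureTheory

/-! ### Lengths of walks. -/

section WalkWeight

variable {V : Type*} {G : SimpleGraph V} (w : Sym2 V → ℝ≥0)

@[simp] theorem walkWeight_nil {x : V} : walkWeight w (Walk.nil : G.Walk x x) = 0 := by
  simp [walkWeight]

@[simp] theorem walkWeight_cons {x y z : V} (h : G.Adj x y) (p : G.Walk y z) :
    walkWeight w (Walk.cons h p) = w s(x, y) + walkWeight w p := by
  simp [walkWeight]

@[simp] theorem walkWeight_append {x y z : V} (p : G.Walk x y) (q : G.Walk y z) :
    walkWeight w (p.append q) = walkWeight w p + walkWeight w q := by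
  simp [walkWeight]

@[simp] theorem walkWeight_reverse {x y : V} (p : G.Walk x y) :
    walkWeight w p.reverse = walkWeight w p := by
  simp [walkWeight]

@[simp] theorem walkWeight_concat {x y z : V} (p : G.Walk x y) (h : G.Adj y z) :
    walkWeight w (p.concat h) = walkWeight w p + w s(y, z) := by
  simp [Walk.concat_eq_append]

theorem walkWeight_bypass_le [DecidableEq V] {x y : V} (p : G.Walk x y) :
    walkWeight w p.bypass ≤ walkWeight w p := by
  unfold walkWeight
  exact ((p.edges_bypass_sublist_edges).map w).sum_le_sum (by simp)

@[simp] theorem walkWeight_mapLe {G' : SimpleGraph V} (h : G ≤ G') {x y : V} (p : G.Walk x y) :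
    walkWeight w (p.mapLe h) = walkWeight w p := by
  simp [walkWeight]

theorem walkWeight_eq_sum_of_nodup [DecidableEq V] {x y : V} (p : G.Walk x y)
    (hp : p.edges.Nodup) :
    walkWeight w p = ∑ e ∈ p.edges.toFinset, w e := by
  rw [walkWeight, List.sum_toFinset _ hp]

theorem sum_edges_le_walkWeight [DecidableEq V] {x y : V} (p : G.Walk x y) :
    ∑ e ∈ p.edges.toFinset, w e ≤ walkWeight w p := by
  have h : p.edges.toFinset = p.edges.dedup.toFinset := by ext; simp
  rw [walkWeight, h, List.sum_toFinset _ (List.nodup_dedup _)]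
  exact ((List.dedup_sublist _).map w).sum_le_sum (by simp)

end WalkWeight

/-! ### Splitting walks. -/

section WalkSplit

variable {V : Type*} {G : SimpleGraph V}

/-- A walk splits at any of its edges. -/
theorem exists_eq_append_cons_of_mem_edges {x y : V} (p : G.Walk x y) {e : Sym2 V}
    (he : e ∈ p.edges) :
    ∃ (a b : V) (h : G.Adj a b) (q : G.Walk x a) (r : G.Walk b y),
      p = q.append (Walk.cons h r) ∧ e = s(a, b) := by
  induction p with
  | nil => simp at he
  | @cons u v z h p ih =>
    rw [Walk.edges_cons, List.mem_cons] at he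
    rcases he with rfl | he
    · exact ⟨u, v, h, Walk.nil, p, rfl, rfl⟩
    · obtain ⟨a, b, hab, q, r, rfl, rfl⟩ := ih he
      exact ⟨a, b, hab, Walk.cons h q, r, rfl, rfl⟩

/-- A walk leaving a set splits at the first edge leaving it. -/
theorem exists_first_exit {x y : V} (p : G.Walk x y) (S : Set V) (hx : x ∈ S) (hy : y ∉ S) :
    ∃ (a b : V) (h : G.Adj a b) (q : G.Walk x a) (r : G.Walk b y),
      p = q.append (Walk.cons h r) ∧ (∀ z ∈ q.support, z ∈ S) ∧ b ∉ S := by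
  induction p with
  | nil => exact absurd hx hy
  | @cons u v z h p ih =>
    by_cases hv : v ∈ S
    · obtain ⟨a, b, hab, q, r, rfl, hq, hb⟩ := ih hv hy
      refine ⟨a, b, hab, Walk.cons h q, r, rfl, ?_, hb⟩
      intro t ht
      rw [Walk.support_cons, List.mem_cons] at ht
      rcases ht with rfl | ht
      · exact hx
      · exact hq t ht
    · refine ⟨u, v, h, Walk.nil, p, rfl, ?_, hv⟩
      intro t ht
      simp only [Walk.support_nil, List.mem_singleton] at ht
      exact ht ▸ hx

end WalkSplit

/-! ### Distances through explored vertices. -/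

section ExploredDist

variable {V : Type*} {G : SimpleGraph V} {w : Sym2 V → ℝ≥0}

theorem exploredDist_le_of_walk {h : List V} {x y : V} (p : G.Walk x y)
    (hp : ∀ z ∈ p.support, z ≠ x → z ≠ y → z ∈ h) :
    exploredDist G w h x y ≤ walkWeight w p := by
  classical
  refine (iInf_le _ ⟨p.bypass, p.bypass_isPath,
    fun z hz => hp z (p.support_bypass_subset_support hz)⟩).trans ?_
  exact_mod_cast walkWeight_bypass_le w p

theorem exploredDist_comm_le {h : List V} {x y : V} :
    exploredDist G w h x y ≤ exploredDist G w h y x := by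
  refine le_iInf fun ⟨p, hp⟩ => ?_
  rw [← walkWeight_reverse]
  refine exploredDist_le_of_walk _ fun z hz h1 h2 => hp.2 z ?_ h2 h1
  simpa using hz

theorem exploredDist_comm {h : List V} {x y : V} :
    exploredDist G w h x y = exploredDist G w h y x :=
  le_antisymm exploredDist_comm_le exploredDist_comm_le

theorem exploredDist_anti {h h' : List V} (hh : h ⊆ h') {x y : V} :
    exploredDist G w h' x y ≤ exploredDist G w h x y :=
  le_iInf fun ⟨_, hp⟩ => exploredDist_le_of_walk _ fun z hz h1 h2 => hh (hp.2 z hz h1 h2)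

theorem exploredDist_self {h : List V} {x : V} : exploredDist G w h x x = 0 :=
  le_antisymm ((exploredDist_le_of_walk Walk.nil (by simp)).trans (by simp)) zero_le

theorem exists_isShortest [Finite V] {h : List V} {x y : V} (p : G.Walk x y)
    (hp : ∀ z ∈ p.support, z ∈ h) : ∃ q : G.Walk x y, IsShortest w h q := by
  classical
  have := Fintype.ofFinite V
  have : Finite {p : G.Walk x y // p.IsPath} := inferInstanceAs (Finite (G.Path x y))
  have hfin : Finite {p : G.Walk x y // IsInternallyExplored h p} :=
    Finite.of_injective (β := {p : G.Walk x y // p.IsPath}) (fun p => ⟨p.1, p.2.1⟩)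
      (fun p q hpq => Subtype.ext (by simpa using hpq))
  have : Nonempty {p : G.Walk x y // IsInternallyExplored h p} :=
    ⟨⟨p.bypass, p.bypass_isPath, fun z hz _ _ => hp z (p.support_bypass_subset_support hz)⟩⟩
  obtain ⟨q, hq⟩ := exists_eq_ciInf_of_finite
    (f := fun p : {p : G.Walk x y // IsInternallyExplored h p} => (walkWeight w p.1 : ℝ≥0∞))
  exact ⟨q.1, q.2, hq⟩

end ExploredDist

/-! ### The sequence of explored edges. -/

section Trace

variable {V : Type*} {G : SimpleGraph V} {w : Sym2 V → ℝ≥0} {δ : ℝ} {s : V}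

/-- `Trace G w δ s h es`: the history `h` arises from `[s]` by exploring the edges in the list `es`
(the most recent one first), each of which was an unblocked boundary edge at that time. -/
inductive Trace (G : SimpleGraph V) (w : Sym2 V → ℝ≥0) (δ : ℝ) (s : V) :
    List V → List (V × V) → Prop
  | init : Trace G w δ s [s] []
  | step {h : List V} {es : List (V × V)} {y x : V} (ht : Trace G w δ s h es)
      (hb : IsBoundary G h y x) (hn : ¬ IsBlocked G w δ h y x) :
      Trace G w δ s (x :: h) ((y, x) :: es)

theorem Trace.nodup {h : List V} {es : List (V × V)} (ht : Trace G w δ s h es) : h.Nodup := by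
  induction ht with
  | init => simp
  | step _ hb _ ih => exact List.nodup_cons.2 ⟨hb.2.2, ih⟩

theorem Trace.length_eq {h : List V} {es : List (V × V)} (ht : Trace G w δ s h es) :
    h.length = es.length + 1 := by
  induction ht with
  | init => simp
  | step _ _ _ ih => simp [ih]

theorem Trace.mem_of_mem {h : List V} {es : List (V × V)} (ht : Trace G w δ s h es) :
    ∀ e ∈ es, G.Adj e.1 e.2 ∧ e.1 ∈ h ∧ e.2 ∈ h := by
  induction ht with
  | init => simp
  | step _ hb _ ih =>
    intro e he
    rcases List.mem_cons.1 he with rfl | he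
    · exact ⟨hb.1, List.mem_cons_of_mem _ hb.2.1, List.mem_cons_self⟩
    · exact ⟨(ih e he).1, List.mem_cons_of_mem _ (ih e he).2.1, List.mem_cons_of_mem _ (ih e he).2.2⟩

theorem Trace.nodup_edges {h : List V} {es : List (V × V)} (ht : Trace G w δ s h es) :
    (es.map fun e => s(e.1, e.2)).Nodup := by
  induction ht with
  | init => simp
  | @step h es y x ht hb _ ih =>
    refine List.nodup_cons.2 ⟨fun hmem => ?_, ih⟩
    obtain ⟨e, he, heq⟩ := List.mem_map.1 hmem
    have := ht.mem_of_mem e he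
    rcases Sym2.eq_iff.1 heq with ⟨h1, h2⟩ | ⟨h1, h2⟩
    · exact hb.2.2 (by have h3 := this.2.2; rwa [h2] at h3)
    · exact hb.2.2 (by have h3 := this.2.1; rwa [h1] at h3)

theorem Trace.exists_walk_to_start {h : List V} {es : List (V × V)} (ht : Trace G w δ s h es) :
    ∀ x ∈ h, ∃ p : G.Walk x s, ∀ z ∈ p.support, z ∈ h := by
  induction ht with
  | init =>
    intro x hx
    obtain rfl : x = s := by simpa using hx
    exact ⟨Walk.nil, by simp⟩
  | @step h es y x ht hb _ ih =>
    intro v hv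
    rcases List.mem_cons.1 hv with rfl | hv
    · obtain ⟨p, hp⟩ := ih y hb.2.1
      refine ⟨Walk.cons hb.1.symm p, fun z hz => ?_⟩
      rw [Walk.support_cons, List.mem_cons] at hz
      rcases hz with rfl | hz
      · exact List.mem_cons_self
      · exact List.mem_cons_of_mem _ (hp z hz)
    · obtain ⟨p, hp⟩ := ih v hv
      exact ⟨p, fun z hz => List.mem_cons_of_mem _ (hp z hz)⟩

theorem Trace.exists_walk {h : List V} {es : List (V × V)} (ht : Trace G w δ s h es) {x y : V}
    (hx : x ∈ h) (hy : y ∈ h) : ∃ p : G.Walk x y, ∀ z ∈ p.support, z ∈ h := by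
  obtain ⟨p, hp⟩ := ht.exists_walk_to_start x hx
  obtain ⟨q, hq⟩ := ht.exists_walk_to_start y hy
  refine ⟨p.append q.reverse, fun z hz => ?_⟩
  rcases (Walk.mem_support_append_iff _ _).1 hz with hz | hz
  · exact hp z hz
  · exact hq z (by simpa using hz)

/-- Lists run backwards in time: `es₂` holds what was explored before `(y, x)`, and `es₁` what came
later. -/
theorem Trace.stage {h : List V} {es₁ es₂ : List (V × V)} {y x : V}
    (ht : Trace G w δ s h (es₁ ++ (y, x) :: es₂)) :
    ∃ h', Trace G w δ s h' es₂ ∧ IsBoundary G h' y x ∧ ¬ IsBlocked G w δ h' y x := by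
  induction es₁ generalizing h with
  | nil =>
    cases ht with
    | step ht hb hn => exact ⟨_, ht, hb, hn⟩
  | cons e es ih =>
    cases ht with
    | step ht hb hn => exact ih ht

end Trace

/-! ### Runs of the algorithm: cost, termination, completeness. -/

section Run

variable {V : Type*} {G : SimpleGraph V} {w : Sym2 V → ℝ≥0} {δ : ℝ} {s : V}

/-- The length of the walk home along the stack, at the current stage. -/
def returnCost (G : SimpleGraph V) (w : Sym2 V → ℝ≥0) (h : List V) : List V → ℝ≥0∞
  | [] => 0
  | [_] => 0
  | x :: v :: rest => exploredDist G w h x v + returnCost G w h (v :: rest)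

theorem returnCost_anti {h h' : List V} (hh : h ⊆ h') :
    ∀ l, returnCost G w h' l ≤ returnCost G w h l
  | [] => le_rfl
  | [_] => le_rfl
  | _ :: v :: rest => add_le_add (exploredDist_anti hh) (returnCost_anti hh (v :: rest))

/-- The invariant of a run of `Blocking_δ`. -/
structure RunInvariant (w : Sym2 V → ℝ≥0) (δ : ℝ) (c : Config G s) (es : List (V × V)) :
    Prop where
  trace : Trace G w δ s c.hist es
  head : ∃ rest, c.stack = c.pos :: rest
  last : ∃ front, c.stack = front ++ [s]
  stack_subset : c.stack ⊆ c.hist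
  hist_subset : c.hist ⊆ c.walk.support
  boundary : ∀ y x, IsBoundary G c.hist y x → y ∈ c.stack ∨ IsBlocked G w δ c.hist y x ∨
    ∃ v ∈ c.stack, ∃ h', h' <:+ c.hist ∧ ∃ u, IsBlockedBy G w δ h' y x u v
  cost : (walkWeight w c.walk : ℝ≥0∞) + returnCost G w c.hist c.stack ≤
    (es.map fun e => ENNReal.ofReal (2 * (2 + δ) * w s(e.1, e.2))).sum

theorem runInvariant_init : RunInvariant w δ (Config.init G s) [] where
  trace := Trace.init
  head := ⟨[], rfl⟩
  last := ⟨[], rfl⟩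
  stack_subset := by simp [Config.init]
  hist_subset := by simp [Config.init]
  boundary y x hb := Or.inl hb.2.1
  cost := by simp [Config.init, returnCost]

/-- The bound on the distance dates from the stage at which the edge was blocked; distances only
shrink as more vertices are explored. -/
theorem IsEligible.walkWeight_le {h : List V} {v y x : V}
    (hel : IsEligible G w δ h v y x) {p : G.Walk v y} (hp : IsShortest w h p) :
    (walkWeight w p : ℝ≥0∞) ≤ ENNReal.ofReal ((1 + δ) * w s(y, x)) := by
  rw [hp.2]
  rcases hel.2.2 with rfl | ⟨h', hh', u, hb⟩
  · rw [exploredDist_self]; exact zero_le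
  · rw [exploredDist_comm]
    exact (exploredDist_anti hh'.subset).trans hb.2.2.2

theorem RunInvariant.step (hδ : 0 ≤ δ) {c c' : Config G s} {es : List (V × V)}
    (hc : RunInvariant w δ c es) (hs : Step G w δ s c c') :
    ∃ es', RunInvariant w δ c' es' := by
  cases hs with
  | @explore h v y x rest W p hyx hel hp =>
    refine ⟨(y, x) :: es, ?_⟩
    have hv : v ∈ h := hc.stack_subset List.mem_cons_self
    obtain ⟨front, hfront⟩ := hc.last
    refine ⟨hc.trace.step hel.1 hel.2.1, ⟨_, rfl⟩, ⟨x :: front, by simpa using hfront⟩, ?_, ?_, ?_, ?_⟩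
    · intro z hz
      rcases List.mem_cons.1 hz with rfl | hz
      · exact List.mem_cons_self
      · exact List.mem_cons_of_mem _ (hc.stack_subset hz)
    · intro z hz
      rcases List.mem_cons.1 hz with rfl | hz
      · exact Walk.end_mem_support _
      · have := hc.hist_subset hz
        simp only [Walk.support_concat, List.mem_append, Walk.mem_support_append_iff]
        exact Or.inl (Or.inl this)
    · intro a b hb
      rcases List.mem_cons.1 hb.2.1 with rfl | ha
      · exact Or.inl List.mem_cons_self
      have hb' : IsBoundary G h a b := ⟨hb.1, ha, fun hbh => hb.2.2 (List.mem_cons_of_mem _ hbh)⟩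
      rcases hc.boundary a b hb' with h1 | ⟨u', v', h2⟩ | ⟨z, hz, h', hh', u, hu⟩
      · exact Or.inl (List.mem_cons_of_mem _ h1)
      · by_cases hvx : v' = x
        · subst hvx
          exact Or.inr (Or.inr ⟨v', List.mem_cons_self, h, List.suffix_cons _ _, u', h2⟩)
        · refine Or.inr (Or.inl ⟨u', v', hb, ⟨h2.2.1.1, List.mem_cons_of_mem _ h2.2.1.2.1, ?_⟩,
            h2.2.2.1, (exploredDist_anti (List.subset_cons_self _ _)).trans h2.2.2.2⟩)
          intro hmem
          rcases List.mem_cons.1 hmem with h3 | h3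
          · exact hvx h3
          · exact h2.2.1.2.2 h3
      · exact Or.inr (Or.inr ⟨z, List.mem_cons_of_mem _ hz, h', hh'.trans (List.suffix_cons _ _),
          u, hu⟩)
    · have h1 : exploredDist G w (x :: h) x v ≤ walkWeight w p + w s(y, x) := by
        have := exploredDist_le_of_walk (w := w) (h := x :: h) (p.concat hyx).reverse ?_
        · simpa [add_comm, Sym2.eq_swap] using this
        · intro z hz hzx hzv
          simp only [Walk.support_reverse, List.mem_reverse, Walk.support_concat, List.mem_append,
            List.mem_singleton] at hz
          rcases hz with hz | hz
          · by_cases hzy : z = y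
            · exact List.mem_cons_of_mem _ (hzy ▸ hel.1.2.1)
            · exact List.mem_cons_of_mem _ (hp.1.2 z hz hzv hzy)
          · exact absurd hz hzx
      have h2 := returnCost_anti (G := G) (w := w) (List.subset_cons_self x h) (v :: rest)
      have h3 := hel.walkWeight_le hp
      have h4 : ((w s(y, x) : ℝ≥0) : ℝ≥0∞) = ENNReal.ofReal (w s(y, x)) := by simp
      -- One half pays for the way out, the other for the way home.
      have h5 : ENNReal.ofReal (2 * (2 + δ) * w s(y, x)) =
          (ENNReal.ofReal ((1 + δ) * w s(y, x)) + w s(y, x)) +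
          (ENNReal.ofReal ((1 + δ) * w s(y, x)) + w s(y, x)) := by
        rw [h4, ← ENNReal.ofReal_add (by positivity) (by positivity),
          ← ENNReal.ofReal_add (by positivity) (by positivity)]
        congr 1; ring
      simp only [List.map_cons, List.sum_cons, returnCost]
      rw [h5]
      simp only [walkWeight_concat, walkWeight_append, ENNReal.coe_add]
      have h6 := hc.cost
      simp only at h6
      calc _ ≤ ((walkWeight w W : ℝ≥0∞) + walkWeight w p + w s(y, x)) +
            ((walkWeight w p + w s(y, x)) + returnCost G w h (v :: rest)) := by gcongr
        _ = ((walkWeight w p : ℝ≥0∞) + w s(y, x)) + (walkWeight w p + w s(y, x)) +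
            (walkWeight w W + returnCost G w h (v :: rest)) := by ring
        _ ≤ _ := by gcongr
  | @back h x v rest W q hend hq =>
    refine ⟨es, ?_⟩
    obtain ⟨front, hfront⟩ := hc.last
    refine ⟨hc.trace, ⟨_, rfl⟩, ?_, fun z hz => hc.stack_subset (List.mem_cons_of_mem _ hz),
      fun z hz => ?_, ?_, ?_⟩
    · cases front with
      | nil => simp at hfront
      | cons a front =>
        simp only [List.cons_append, List.cons.injEq] at hfront
        exact ⟨front, hfront.2⟩
    · exact (Walk.mem_support_append_iff _ _).2 (Or.inl (hc.hist_subset hz))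
    · intro a b hb
      rcases hc.boundary a b hb with h1 | h2 | ⟨z, hz, h', hh', u, hu⟩
      · rcases List.mem_cons.1 h1 with h1 | h1
        · by_contra hcon
          rw [not_or, not_or] at hcon
          exact hend a b ⟨hb, hcon.2.1, Or.inl h1⟩
        · exact Or.inl h1
      · exact Or.inr (Or.inl h2)
      · rcases List.mem_cons.1 hz with rfl | hz
        · by_contra hcon
          rw [not_or, not_or] at hcon
          exact hend a b ⟨hb, hcon.2.1, Or.inr ⟨h', hh', u, hu⟩⟩
        · exact Or.inr (Or.inr ⟨z, hz, h', hh', u, hu⟩)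
    · have h6 := hc.cost
      simp only [returnCost, ← hq.2] at h6
      simpa [add_assoc] using h6

theorem RunInvariant.of_reachable (hδ : 0 ≤ δ) {c : Config G s}
    (hc : Relation.ReflTransGen (Step G w δ s) (Config.init G s) c) :
    ∃ es, RunInvariant w δ c es := by
  induction hc with
  | refl => exact ⟨[], runInvariant_init⟩
  | tail _ hs ih =>
    obtain ⟨es, hes⟩ := ih
    exact hes.step hδ hs

/-- Every run of the algorithm is finite. -/
theorem acc_step [Fintype V] (c : Config G s) : Acc (fun c' c => Step G w δ s c c') c := by
  classical
  -- Exploring lengthens the stack by one but uses up an unexplored vertex, which counts twice;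
  -- returning shortens the stack.
  refine Subrelation.accessible (r := InvImage (· < ·) fun c : Config G s =>
    2 * (Fintype.card V - c.hist.toFinset.card) + c.stack.length) ?_
    ((InvImage.wf _ wellFounded_lt).apply c)
  intro c' c hs
  cases hs with
  | @explore h v y x rest W p hyx hel hp =>
    have h1 : (x :: h).toFinset.card = h.toFinset.card + 1 := by
      rw [List.toFinset_cons, Finset.card_insert_of_notMem (by simpa using hel.1.2.2)]
    have h2 := Finset.card_le_univ (x :: h).toFinset
    simp only [InvImage, List.length_cons]
    omega
  | @back h x v rest W q hend hq =>
    simp [InvImage]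

/-- When the algorithm stops, the agent is back at the start and everything is explored. -/
theorem RunInvariant.of_final [Finite V] (hG : G.Connected) {c : Config G s} {es : List (V × V)}
    (hc : RunInvariant w δ c es) (hfin : ∀ c', ¬ Step G w δ s c c') :
    c.pos = s ∧ ∀ x, x ∈ c.hist := by
  obtain ⟨h, pos, W, stack⟩ := c
  obtain ⟨rest, hrest⟩ := hc.head
  simp only at hrest
  subst hrest
  have hpos : pos ∈ h := hc.stack_subset List.mem_cons_self
  have hend : ∀ y z, ¬ IsEligible G w δ h pos y z := by
    intro y x hel
    obtain ⟨p, hp⟩ := hc.trace.exists_walk hpos hel.1.2.1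
    obtain ⟨q, hq⟩ := exists_isShortest (w := w) p hp
    exact hfin _ (Step.explore W q hel.1.1 hel hq)
  have hnil : rest = [] := by
    cases rest with
    | nil => rfl
    | cons v rest =>
      obtain ⟨p, hp⟩ := hc.trace.exists_walk hpos
        (hc.stack_subset (List.mem_cons_of_mem _ List.mem_cons_self) : v ∈ h)
      obtain ⟨q, hq⟩ := exists_isShortest (w := w) p hp
      exact absurd (Step.back W q hend hq) (hfin _)
  subst hnil
  have hs : pos = s := by
    obtain ⟨front, hfront⟩ := hc.last
    simp only at hfront
    cases front with
    | nil => simpa using hfront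
    | cons a f => simp at hfront
  refine ⟨hs, ?_⟩
  have hblocked : ∀ y x, IsBoundary G h y x → IsBlocked G w δ h y x := by
    intro y x hb
    by_contra hn
    rcases hc.boundary y x hb with h1 | h2 | ⟨z, hz, h', hh', u, hu⟩
    · exact hend y x ⟨hb, hn, Or.inl (by simpa using h1)⟩
    · exact hn h2
    · obtain rfl : z = pos := by simpa using hz
      exact hend y x ⟨hb, hn, Or.inr ⟨h', hh', u, hu⟩⟩
  by_contra hcon
  push Not at hcon
  obtain ⟨x, hx⟩ := hcon
  simp only at hx
  obtain ⟨p⟩ := hG.preconnected pos x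
  obtain ⟨a, b, hab, q, -, -, hq, hb⟩ := exists_first_exit p {z | z ∈ h} hpos hx
  have hne : {e : V × V | IsBoundary G h e.1 e.2}.Nonempty :=
    ⟨(a, b), hab, hq a (Walk.end_mem_support _), hb⟩
  -- A lightest boundary edge cannot be blocked.
  obtain ⟨e, he, hmin⟩ := Set.exists_min_image _ (fun e : V × V => w s(e.1, e.2))
    (Set.toFinite {e : V × V | IsBoundary G h e.1 e.2}) hne
  obtain ⟨u', v', hb'⟩ := hblocked e.1 e.2 he
  exact absurd hb'.2.2.1 (not_lt.2 (hmin (u', v') hb'.2.1))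

end Run

/-! ### Circuits through explored edges. -/

section Circuit

variable {V : Type*} {G : SimpleGraph V} {w : Sym2 V → ℝ≥0} {δ : ℝ} {s : V}

/-- A walk from `z` to `a` stays in `F₀` until it first uses the edge `ab`, and there it is at `a`
or `b`. -/
theorem reachable_or_reachable {F F₀ : SimpleGraph V} (hF : F.Connected) {a b : V}
    (h : ∀ x y, F.Adj x y → s(x, y) ≠ s(a, b) → F₀.Adj x y) (z : V) :
    F₀.Reachable a z ∨ F₀.Reachable b z := by
  obtain ⟨p⟩ := hF.preconnected z a
  induction p with
  | nil => exact Or.inl (Reachable.refl _)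
  | @cons u v t huv p ih =>
    by_cases he : s(u, v) = s(t, b)
    · rcases Sym2.eq_iff.1 he with ⟨rfl, -⟩ | ⟨rfl, -⟩
      · exact Or.inl (Reachable.refl _)
      · exact Or.inr (Reachable.refl _)
    · have := (h u v huv he).symm.reachable
      exact (ih h).imp (·.trans this) (·.trans this)

theorem connected_of_reachable {F F₀ : SimpleGraph V} (hF : F.Connected) {a b : V}
    (h : ∀ x y, F.Adj x y → s(x, y) ≠ s(a, b) → F₀.Adj x y) (hab : F₀.Reachable a b) :
    F₀.Connected := by
  refine (connected_iff_exists_forall_reachable _).2 ⟨a, fun z => ?_⟩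
  rcases reachable_or_reachable hF h z with h1 | h1
  · exact h1
  · exact hab.trans h1

theorem reachable_fromEdgeSet_of_mem_support {E : Set (Sym2 V)} {x y : V} (p : G.Walk x y)
    (hp : ∀ e ∈ p.edges, e ∈ E) : ∀ z ∈ p.support, (fromEdgeSet E).Reachable x z := by
  induction p with
  | nil =>
    intro z hz
    obtain rfl : z = _ := by simpa using hz
    exact Reachable.refl _
  | @cons u v t huv p ih =>
    intro z hz
    rw [Walk.support_cons, List.mem_cons] at hz
    rcases hz with rfl | hz
    · exact Reachable.refl _
    · have h1 : (fromEdgeSet E).Adj u v := ⟨hp _ (by simp), huv.ne⟩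
      exact h1.reachable.trans (ih (fun e he => hp e (by simp [he])) z hz)

theorem exists_first_of_exists {α : Type*} (p : α → Prop) :
    ∀ l : List α, (∃ a ∈ l, p a) → ∃ l₁ a l₂, l = l₁ ++ a :: l₂ ∧ p a ∧ ∀ b ∈ l₁, ¬ p b
  | [], h => by simp at h
  | a :: l, h => by
    by_cases ha : p a
    · exact ⟨[], a, l, rfl, ha, by simp⟩
    · obtain ⟨b, hb, hpb⟩ := h
      rcases List.mem_cons.1 hb with rfl | hb
      · exact absurd hpb ha
      · obtain ⟨l₁, c, l₂, rfl, hc, hl⟩ := exists_first_of_exists p l ⟨b, hb, hpb⟩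
        refine ⟨a :: l₁, c, l₂, rfl, hc, fun d hd => ?_⟩
        rcases List.mem_cons.1 hd with rfl | hd
        · exact ha
        · exact hl d hd

theorem exists_walk_of_circuit {H : SimpleGraph V} {x : V} {C : H.Walk x x} (hC : C.edges.Nodup)
    {e : Sym2 V} (he : e ∈ C.edges) : ∃ (a b : V) (q : H.Walk a b), e = s(a, b) ∧
      e ∉ q.edges ∧ (∀ f ∈ q.edges, f ∈ C.edges) ∧ walkWeight w C = w e + walkWeight w q := by
  obtain ⟨a, b, hab, q, r, rfl, rfl⟩ := exists_eq_append_cons_of_mem_edges C he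
  refine ⟨b, a, r.append q, Sym2.eq_swap, ?_, ?_, ?_⟩
  · simp only [Walk.edges_append, Walk.edges_cons, List.nodup_append, List.nodup_cons,
      List.mem_cons, List.mem_append] at hC ⊢
    rintro (h | h)
    · exact hC.2.1.1 h
    · exact hC.2.2 _ h _ (Or.inl rfl) rfl
  · intro f hf
    simp only [Walk.edges_append, Walk.edges_cons, List.mem_append, List.mem_cons] at hf ⊢
    tauto
  · simp; ring

/-- If the edge `(y, x)` was explored while a walk from `y` to `x` avoiding it consists of edges that
are at most as heavy, and those of the same weight are not explored later, then that walk is long,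
or an edge on it of the same weight is never explored. -/
theorem Trace.lt_walkWeight {h : List V} {es₁ es₂ : List (V × V)} {y x : V}
    (ht : Trace G w δ s h (es₁ ++ (y, x) :: es₂)) (q : G.Walk y x) (hq : s(y, x) ∉ q.edges)
    (hle : ∀ f ∈ q.edges, w f ≤ w s(y, x))
    (hlater : ∀ e ∈ es₁, s(e.1, e.2) ∈ q.edges → w s(e.1, e.2) ≠ w s(y, x)) :
    (1 + δ) * w s(y, x) < walkWeight w q ∨ ∃ f ∈ q.edges, w f = w s(y, x) ∧
      f ∉ (es₁ ++ (y, x) :: es₂).map fun e => s(e.1, e.2) := by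
  obtain ⟨h', ht', hb, hn⟩ := ht.stage
  -- The first edge of `q` leaving the set explored at that stage is a boundary edge. If it is
  -- lighter than `(y, x)`, it does not block, so `q` is long already up to `b`. If it is equally
  -- heavy, it was not explored earlier, as `b` is unexplored, nor later, by `hlater`.
  obtain ⟨a, b, hab, q₁, q₂, rfl, hq₁, hb'⟩ := exists_first_exit q {z | z ∈ h'} hb.2.1 hb.2.2
  have hmem : s(a, b) ∈ (q₁.append (Walk.cons hab q₂)).edges := by simp
  rcases (hle _ hmem).lt_or_eq with hlt | heq
  · left
    by_contra hcon
    rw [not_lt] at hcon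
    refine hn ⟨a, b, hb, ⟨hab, hq₁ a (Walk.end_mem_support _), hb'⟩, hlt, ?_⟩
    have h1 : exploredDist G w h' y b ≤ walkWeight w (q₁.concat hab) := by
      refine exploredDist_le_of_walk _ fun z hz _ hzb => ?_
      rw [Walk.support_concat, List.mem_append, List.mem_singleton] at hz
      exact hq₁ z (hz.resolve_right hzb)
    refine h1.trans ?_
    rw [← ENNReal.ofReal_coe_nnreal]
    refine ENNReal.ofReal_le_ofReal (le_trans ?_ hcon)
    norm_cast
    simp
  · right
    refine ⟨_, hmem, heq, fun hin => ?_⟩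
    obtain ⟨e, he, hee⟩ := List.mem_map.1 hin
    rcases List.mem_append.1 he with he | he
    · exact hlater e he (hee ▸ hmem) (hee ▸ heq)
    · rcases List.mem_cons.1 he with rfl | he
      · exact hq (hee ▸ hmem)
      · have h2 := ht'.mem_of_mem e he
        rcases Sym2.eq_iff.1 hee with ⟨-, h3⟩ | ⟨h3, -⟩
        · exact hb' (h3 ▸ h2.2.2)
        · exact hb' (h3 ▸ h2.2.1)

end Circuit

/-! ### A minimum spanning tree preferring explored edges. -/

section LightTree

variable {V : Type*} [DecidableEq V] {G : SimpleGraph V} {w : Sym2 V → ℝ≥0} {δ : ℝ} {s : V}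
  {P T : Finset (Sym2 V)}

/-- `T` is the edge set of a connected spanning subgraph of `G` of minimum weight that, among these,
uses as few edges as possible, those outside `P` being counted twice. -/
structure IsLightSpanning (G : SimpleGraph V) (w : Sym2 V → ℝ≥0) (P T : Finset (Sym2 V)) :
    Prop where
  subset : (T : Set (Sym2 V)) ⊆ G.edgeSet
  connected : (fromEdgeSet (T : Set (Sym2 V))).Connected
  minimal : ∀ T' : Finset (Sym2 V), (T' : Set (Sym2 V)) ⊆ G.edgeSet →
    (fromEdgeSet (T' : Set (Sym2 V))).Connected →
      ∑ e ∈ T, w e < ∑ e ∈ T', w e ∨ ∑ e ∈ T, w e = ∑ e ∈ T', w e ∧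
        ∑ e ∈ T, (if e ∈ P then 1 else 2) ≤ ∑ e ∈ T', if e ∈ P then 1 else 2

theorem exists_isLightSpanning [Fintype V] (hG : G.Connected) (w : Sym2 V → ℝ≥0)
    (P : Finset (Sym2 V)) : ∃ T, IsLightSpanning G w P T := by
  classical
  let A : Finset (Finset (Sym2 V)) := G.edgeFinset.powerset.filter fun T =>
    (fromEdgeSet (T : Set (Sym2 V))).Connected
  have hA : A.Nonempty := ⟨G.edgeFinset, by simpa [A] using hG⟩
  obtain ⟨T, hT, hmin⟩ := A.exists_min_image
    (fun T => toLex (∑ e ∈ T, w e, ∑ e ∈ T, if e ∈ P then 1 else 2)) hA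
  simp only [A, Finset.mem_filter, Finset.mem_powerset] at hT hmin
  refine ⟨T, fun e he => by simpa using hT.1 he, hT.2, fun T' h1 h2 => ?_⟩
  have := hmin T' ⟨fun e he => by simpa using h1 he, h2⟩
  simpa [Prod.Lex.le_iff] using this

/-- The count in the minimality of `T` is what excludes superfluous edges of weight zero. -/
theorem IsLightSpanning.not_connected_erase (hT : IsLightSpanning G w P T) {e : Sym2 V}
    (he : e ∈ T) : ¬ (fromEdgeSet (T.erase e : Set (Sym2 V))).Connected := by
  intro hc
  have h1 := hT.minimal (T.erase e)
    (fun f hf => hT.subset (Finset.mem_of_mem_erase (Finset.mem_coe.1 hf))) (by simpa using hc)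
  have h2 := Finset.add_sum_erase T w he
  have h3 := Finset.add_sum_erase T (fun e => if e ∈ P then 1 else 2) he
  have h4 : 1 ≤ if e ∈ P then 1 else 2 := by split_ifs <;> simp
  rcases h1 with h1 | ⟨-, h1⟩
  · rw [← h2] at h1
    exact absurd h1 (not_lt.2 le_add_self)
  · omega

theorem IsLightSpanning.isAcyclic (hT : IsLightSpanning G w P T) :
    (fromEdgeSet (T : Set (Sym2 V))).IsAcyclic := by
  rw [isAcyclic_iff_forall_adj_isBridge]
  intro a b hab
  by_contra hn
  refine hT.not_connected_erase (e := s(a, b)) (by simpa using hab.1) ?_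
  have := hT.connected.connected_delete_edge_of_not_isBridge hn
  convert this using 1
  ext x y
  simp [fromEdgeSet_adj]

theorem IsLightSpanning.isTree (hT : IsLightSpanning G w P T) :
    (fromEdgeSet (T : Set (Sym2 V))).IsTree := ⟨hT.connected, hT.isAcyclic⟩

/-- An edge of `T` of maximum weight on a circuit in `T ∪ P` belongs to `P`. -/
theorem IsLightSpanning.mem_of_circuit (hT : IsLightSpanning G w P T)
    (hP : (P : Set (Sym2 V)) ⊆ G.edgeSet) {H : SimpleGraph V} {a b : V} (hab : s(a, b) ∈ T)
    (q : H.Walk a b) (hq : s(a, b) ∉ q.edges)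
    (hqe : ∀ f ∈ q.edges, f ∈ T ∪ P ∧ w f ≤ w s(a, b)) : s(a, b) ∈ P := by
  by_contra hnP
  set F₀ := fromEdgeSet (T.erase s(a, b) : Set (Sym2 V)) with hF₀
  have hadj : ∀ x y, (fromEdgeSet (T : Set (Sym2 V))).Adj x y → s(x, y) ≠ s(a, b) →
      F₀.Adj x y := by
    intro x y hxy hne
    rw [fromEdgeSet_adj] at hxy
    simp only [hF₀, fromEdgeSet_adj, Finset.mem_coe, Finset.mem_erase]
    exact ⟨⟨hne, hxy.1⟩, hxy.2⟩
  have hb : ¬ F₀.Reachable a b := fun h =>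
    hT.not_connected_erase hab (connected_of_reachable hT.connected hadj h)
  -- Deleting `ab` from `T` leaves a cut, which `q` crosses in an edge outside `T`, hence in `P`.
  -- Swapping it for `ab` does not raise the weight and lowers the count.
  obtain ⟨x, y, hxy, q₁, q₂, rfl, hq₁, hy⟩ :=
    exists_first_exit q {z | F₀.Reachable a z} (Reachable.refl _) hb
  have hx : F₀.Reachable a x := hq₁ x (Walk.end_mem_support _)
  have hmem : s(x, y) ∈ (q₁.append (Walk.cons hxy q₂)).edges := by simp
  have hne : s(x, y) ≠ s(a, b) := fun h => hq (h ▸ hmem)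
  have hnT : s(x, y) ∉ T := fun h =>
    hy (hx.trans (hadj x y ⟨h, hxy.ne⟩ hne).reachable)
  have hxyP : s(x, y) ∈ P := by
    simpa [hnT] using (hqe _ hmem).1
  have hnE : s(x, y) ∉ T.erase s(a, b) := fun h => hnT (Finset.mem_of_mem_erase h)
  have hby : F₀.Reachable b y :=
    (reachable_or_reachable hT.connected hadj y).resolve_left hy
  set F₁ := fromEdgeSet ((insert s(x, y) (T.erase s(a, b)) : Finset (Sym2 V)) : Set (Sym2 V))
    with hF₁
  have hle : F₀ ≤ F₁ := fromEdgeSet_mono (by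
    intro e he; exact Finset.mem_coe.2 (Finset.mem_insert_of_mem (Finset.mem_coe.1 he)))
  have hxy₁ : F₁.Adj x y := by simp [hF₁, hxy.ne]
  have hconn : F₁.Connected := connected_of_reachable hT.connected
    (fun u v huv hne => hle (hadj u v huv hne))
    (((hx.mono hle).trans hxy₁.reachable).trans (hby.mono hle).symm)
  have h1 := hT.minimal _ (by
    intro e he
    rcases Finset.mem_insert.1 (Finset.mem_coe.1 he) with rfl | he
    · exact hP hxyP
    · exact hT.subset (Finset.mem_of_mem_erase he)) hconn
  rw [Finset.sum_insert hnE, Finset.sum_insert hnE] at h1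
  have h2 := Finset.add_sum_erase T w hab
  have h3 := Finset.add_sum_erase T (fun e => if e ∈ P then 1 else 2) hab
  have h4 := (hqe _ hmem).2
  rcases h1 with h1 | ⟨-, h1⟩
  · rw [← h2] at h1
    exact absurd h1 (not_lt.2 (by gcongr))
  · simp only [hnP, hxyP, if_true, if_false] at h1 h3
    omega

/-- The edges of a tour compete with `T`. The hypothesis `hne` keeps the infimum in `opt` from being
taken over the empty set. -/
theorem IsLightSpanning.sum_le_opt (hT : IsLightSpanning G w P T)
    (hne : ∃ (s : V) (W : G.Walk s s), ∀ x, x ∈ W.support) : ∑ e ∈ T, w e ≤ opt G w := by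
  obtain ⟨s, W, hW⟩ := hne
  refine le_csInf ⟨_, s, W, hW, rfl⟩ ?_
  rintro c ⟨s, W, hW, rfl⟩
  refine le_trans ?_ (sum_edges_le_walkWeight w W)
  have hc : (fromEdgeSet (W.edges.toFinset : Set (Sym2 V))).Connected :=
    (connected_iff_exists_forall_reachable _).2 ⟨s, fun z =>
      reachable_fromEdgeSet_of_mem_support W (by simp) z (hW z)⟩
  rcases hT.minimal W.edges.toFinset (fun e he => W.edges_subset_edgeSet (by simpa using he)) hc
    with h | h
  · exact h.le
  · exact h.1.le

theorem Trace.edges_subset {h : List V} {es : List (V × V)} (ht : Trace G w δ s h es) :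
    (((es.map fun e => s(e.1, e.2)).toFinset : Finset (Sym2 V)) : Set (Sym2 V)) ⊆ G.edgeSet := by
  intro e he
  obtain ⟨f, hf, rfl⟩ : ∃ f ∈ es, s(f.1, f.2) = e := by simpa using he
  exact (ht.mem_of_mem f hf).1

/-- The union of the explored edges and a light spanning tree has only long circuits. -/
theorem Trace.lt_walkWeight_of_isTrail (hδ : 0 ≤ δ) {h : List V} {es : List (V × V)}
    (ht : Trace G w δ s h es) (hP : P = (es.map fun e => s(e.1, e.2)).toFinset)
    (hT : IsLightSpanning G w P T) {H : SimpleGraph V}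
    (hH : H = fromEdgeSet ((T ∪ P : Finset (Sym2 V)) : Set (Sym2 V))) {x : V} (C : H.Walk x x) (hC : C.IsTrail)
    {f : Sym2 V} (hf : f ∈ C.edges) : (2 + δ) * w f < walkWeight w C := by
  have hPG : (P : Set (Sym2 V)) ⊆ G.edgeSet := hP ▸ ht.edges_subset
  have hHG : H ≤ G := by
    rw [hH, ← fromEdgeSet_edgeSet G]
    refine fromEdgeSet_mono fun e he => ?_
    rcases Finset.mem_union.1 (Finset.mem_coe.1 he) with he | he
    · exact hT.subset he
    · exact hPG he
  have hHe : ∀ e ∈ C.edges, e ∈ T ∪ P := by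
    intro e he
    have := C.edges_subset_edgeSet he
    rw [hH, edgeSet_fromEdgeSet] at this
    exact Finset.mem_coe.1 this.1
  have hnd := hC.edges_nodup
  obtain ⟨m, hm, hmax⟩ := C.edges.toFinset.exists_max_image w ⟨f, by simpa using hf⟩
  simp only [List.mem_toFinset] at hm hmax
  -- All heaviest edges of `C` are explored edges, which will exclude the second alternative of
  -- `Trace.lt_walkWeight`.
  have hexch : ∀ e ∈ C.edges, w e = w m → e ∈ P := by
    intro e he hem
    by_contra hePn
    have heT : e ∈ T := by simpa [hePn] using hHe e he
    obtain ⟨a, b, q, rfl, hq1, hq2, -⟩ := exists_walk_of_circuit (w := w) hnd he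
    exact hePn (hT.mem_of_circuit hPG heT q hq1 fun f hf =>
      ⟨hHe f (hq2 f hf), hem ▸ hmax f (hq2 f hf)⟩)
  have hex : ∃ e ∈ es, s(e.1, e.2) ∈ C.edges ∧ w s(e.1, e.2) = w m := by
    have := hexch m hm rfl
    rw [hP, List.mem_toFinset] at this
    obtain ⟨e, he, rfl⟩ := List.mem_map.1 this
    exact ⟨e, he, hm, rfl⟩
  -- As the newest edge comes first, this picks the heaviest edge of `C` that was explored last.
  obtain ⟨es₁, ⟨y, x'⟩, es₂, rfl, ⟨he1, he2⟩, hfirst⟩ :=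
    exists_first_of_exists (fun e : V × V => s(e.1, e.2) ∈ C.edges ∧ w s(e.1, e.2) = w m) es hex
  simp only at he1 he2
  obtain ⟨q, hq1, hq2, hq3⟩ : ∃ q : H.Walk y x', s(y, x') ∉ q.edges ∧
      (∀ f ∈ q.edges, f ∈ C.edges) ∧ walkWeight w C = w s(y, x') + walkWeight w q := by
    obtain ⟨a, b, q, hab, hq1, hq2, hq3⟩ := exists_walk_of_circuit (w := w) hnd he1
    rcases Sym2.eq_iff.1 hab with ⟨rfl, rfl⟩ | ⟨rfl, rfl⟩
    · exact ⟨q, hq1, hq2, hq3⟩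
    · exact ⟨q.reverse, by simpa using hq1, by simpa using hq2, by simpa using hq3⟩
  have key := ht.lt_walkWeight (q.mapLe hHG) (by simpa using hq1)
    (fun f hf => he2 ▸ hmax f (hq2 f (by simpa using hf)))
    (fun e he hee hw => hfirst e he ⟨hq2 _ (by simpa using hee), hw.trans he2⟩)
  rw [walkWeight_mapLe] at key
  rcases key with key | ⟨g, hg1, hg2, hg3⟩
  · have h1 : (w f : ℝ) ≤ w s(y, x') := by rw [he2]; exact_mod_cast hmax f hf
    have h2 : (2 + δ) * w f ≤ (2 + δ) * w s(y, x') := by gcongr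
    rw [hq3]
    push_cast
    linarith
  · exfalso
    have h1 := hexch g (hq2 g (by simpa using hg1)) (hg2.trans he2)
    rw [hP, List.mem_toFinset] at h1
    exact hg3 h1

end LightTree

/-! ### Forests against spanning trees. -/

section Forest

variable {V : Type*} {F : SimpleGraph V}

theorem exists_adj_dist_lt (hF : F.Connected) (ρ : V) {v : V} (hv : v ≠ ρ) :
    ∃ a, F.Adj v a ∧ F.dist a ρ < F.dist v ρ := by
  obtain ⟨p, hp⟩ := hF.exists_walk_length_eq_dist v ρ
  cases p with
  | nil => exact absurd rfl hv
  | @cons _ a _ h p =>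
    refine ⟨a, h, ?_⟩
    have := dist_le p
    simp only [Walk.length_cons] at hp
    omega

/-- The edges of a tree correspond to the vertices other than the root. -/
theorem exists_sum_edges_eq_sum_vertices [Fintype V] [DecidableEq V] [Fintype F.edgeSet]
    (hF : F.IsTree) (ρ : V) : ∃ ψ : V → Sym2 V, (∀ v, v ≠ ρ → v ∈ ψ v) ∧
      ∀ k : Sym2 V → ℝ, ∑ e ∈ F.edgeFinset, k e = ∑ v ∈ Finset.univ.erase ρ, k (ψ v) := by
  have h0 : ∀ v, ∃ a, v ≠ ρ → F.Adj v a ∧ F.dist a ρ < F.dist v ρ := by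
    intro v
    by_cases hv : v = ρ
    · exact ⟨v, fun h => absurd hv h⟩
    · obtain ⟨a, ha⟩ := exists_adj_dist_lt hF.connected ρ hv
      exact ⟨a, fun _ => ha⟩
  choose par hpar using h0
  -- Two vertices that are each other's parent would each be closer to the root than the other.
  have hinj : Set.InjOn (fun v => s(v, par v)) (Finset.univ.erase ρ : Finset V) := by
    intro u hu v hv huv
    have hu' : u ≠ ρ := by simpa using hu
    have hv' : v ≠ ρ := by simpa using hv
    rcases Sym2.eq_iff.1 huv with ⟨h, -⟩ | ⟨h1, h2⟩
    · exact h
    · have h3 := (hpar u hu').2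
      have h4 := (hpar v hv').2
      rw [h2] at h3
      rw [← h1] at h4
      omega
  have himg : (Finset.univ.erase ρ).image (fun v => s(v, par v)) = F.edgeFinset := by
    refine Finset.eq_of_subset_of_card_le ?_ ?_
    · intro e he
      obtain ⟨v, hv, rfl⟩ := Finset.mem_image.1 he
      rw [mem_edgeFinset]
      exact (hpar v (by simpa using hv)).1
    · rw [Finset.card_image_of_injOn hinj, Finset.card_erase_of_mem (Finset.mem_univ _),
        Finset.card_univ, ← hF.card_edgeFinset]
      simp
  refine ⟨fun v => s(v, par v), fun v _ => Sym2.mem_mk_left _ _, fun k => ?_⟩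
  rw [← himg, Finset.sum_image hinj]

theorem inf_map_le {g : V → ℝ} {e : Sym2 V} {v : V} (hv : v ∈ e) : (e.map g).inf ≤ g v := by
  induction e with
  | h a b => rcases Sym2.mem_iff.1 hv with rfl | rfl <;> simp

theorem le_sup_map {g : V → ℝ} {e : Sym2 V} {v : V} (hv : v ∈ e) : g v ≤ (e.map g).sup := by
  induction e with
  | h a b => rcases Sym2.mem_iff.1 hv with rfl | rfl <;> simp

theorem inf_map_nonneg {g : V → ℝ} (hg : ∀ v, 0 ≤ g v) (e : Sym2 V) : 0 ≤ (e.map g).inf := by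
  induction e with
  | h a b => simp [hg]

/-- A forest carries at most as much of a weight on the vertices as any spanning tree. -/
theorem sum_inf_le_sum_sup [Fintype V] [DecidableEq V] {E T : Finset (Sym2 V)}
    (hE : (fromEdgeSet (E : Set (Sym2 V))).IsAcyclic) (hEd : ∀ e ∈ E, ¬ e.IsDiag)
    (hT : (fromEdgeSet (T : Set (Sym2 V))).IsTree) (hTd : ∀ e ∈ T, ¬ e.IsDiag)
    {g : V → ℝ} (hg : ∀ v, 0 ≤ g v) :
    ∑ e ∈ E, (e.map g).inf ≤ ∑ e ∈ T, (e.map g).sup := by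
  classical
  have := hT.connected.nonempty
  obtain ⟨ρ⟩ := this
  have : Nonempty V := ⟨ρ⟩
  obtain ⟨F, hEF, -, hF⟩ := (connected_top (V := V)).exists_isTree_le_of_le_of_isAcyclic le_top hE
  have hTeq : T = (fromEdgeSet (T : Set (Sym2 V))).edgeFinset := by
    ext e
    simp only [mem_edgeFinset, edgeSet_fromEdgeSet, Set.mem_sdiff, Finset.mem_coe]
    exact ⟨fun h => ⟨h, hTd e h⟩, fun h => h.1⟩
  have hEsub : E ⊆ F.edgeFinset := by
    intro e he
    rw [mem_edgeFinset]
    refine edgeSet_mono hEF ?_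
    rw [edgeSet_fromEdgeSet]
    exact ⟨he, hEd e he⟩
  -- With the same root for both trees, both edge sums become sums over the same vertices, between
  -- which `g v` mediates.
  obtain ⟨ψ, hψ, hsum⟩ := exists_sum_edges_eq_sum_vertices hF ρ
  obtain ⟨φ, hφ, hsum'⟩ := exists_sum_edges_eq_sum_vertices hT ρ
  calc ∑ e ∈ E, (e.map g).inf ≤ ∑ e ∈ F.edgeFinset, (e.map g).inf :=
        Finset.sum_le_sum_of_subset_of_nonneg hEsub fun e _ _ => inf_map_nonneg hg e
    _ = ∑ v ∈ Finset.univ.erase ρ, ((ψ v).map g).inf := hsum _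
    _ ≤ ∑ v ∈ Finset.univ.erase ρ, g v :=
        Finset.sum_le_sum fun v hv => inf_map_le (hψ v (by simpa using hv))
    _ ≤ ∑ v ∈ Finset.univ.erase ρ, ((φ v).map g).sup :=
        Finset.sum_le_sum fun v hv => le_sup_map (hφ v (by simpa using hv))
    _ = _ := (hsum' fun e => (e.map g).sup).symm.trans (by rw [← hTeq])

end Forest

/-! ### Heavy edges in a ball. -/

section Near

variable {V : Type*} {H : SimpleGraph V} {w : Sym2 V → ℝ≥0} {δ r : ℝ}

/-- `y` is at distance at most `r` from `x`. -/
def Near (H : SimpleGraph V) (w : Sym2 V → ℝ≥0) (r : ℝ) (x y : V) : Prop :=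
  ∃ p : H.Walk x y, (walkWeight w p : ℝ) ≤ r

theorem Near.symm {x y : V} (h : Near H w r x y) : Near H w r y x :=
  let ⟨p, hp⟩ := h
  ⟨p.reverse, by simpa using hp⟩

theorem Near.mono {r' : ℝ} {x y : V} (h : Near H w r x y) (hr : r ≤ r') : Near H w r' x y :=
  let ⟨p, hp⟩ := h
  ⟨p, hp.trans hr⟩

theorem near_self (hr : 0 ≤ r) (x : V) : Near H w r x x := ⟨Walk.nil, by simpa using hr⟩

theorem Near.of_adj {x y z : V} (h : Near H w r y z) (hxy : H.Adj x y) :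
    Near H w (r + w s(x, y)) x z := by
  obtain ⟨p, hp⟩ := h
  refine ⟨Walk.cons hxy p, ?_⟩
  rw [walkWeight_cons]; push_cast; linarith

theorem Near.exists_isPath {x y : V} (h : Near H w r x y) :
    ∃ p : H.Walk x y, p.IsPath ∧ (walkWeight w p : ℝ) ≤ r := by
  classical
  obtain ⟨p, hp⟩ := h
  exact ⟨p.bypass, p.bypass_isPath, le_trans (by exact_mod_cast walkWeight_bypass_le w p) hp⟩

/-- The graph has only long circuits: the edges of a circuit of length `L` have weight less
than `L / (2 + δ)`. -/
def LongCircuits (H : SimpleGraph V) (w : Sym2 V → ℝ≥0) (δ : ℝ) : Prop :=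
  ∀ (x : V) (C : H.Walk x x), C.IsTrail → ∀ f ∈ C.edges, (2 + δ) * w f < walkWeight w C

/-- Shortcut `q` to a path `q'` and close it by `ab` to a circuit. The last clause records that an
edge lost in the shortcut saves its weight. -/
theorem LongCircuits.exists_detour (hH : LongCircuits H w δ) {a b : V} (hab : H.Adj a b)
    (q : H.Walk a b) (hq : s(a, b) ∉ q.edges) : ∃ q' : H.Walk a b,
      (1 + δ) * w s(a, b) < walkWeight w q' ∧ walkWeight w q' ≤ walkWeight w q ∧
      (∀ f ∈ q'.edges, (2 + δ) * w f < w s(a, b) + walkWeight w q') ∧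
      ∀ f ∈ q.edges, f ∈ q'.edges ∨ w f + walkWeight w q' ≤ walkWeight w q := by
  classical
  have hb : s(a, b) ∉ q.bypass.edges := fun h => hq (q.edges_bypass_subset_edges h)
  have htr : (Walk.cons hab.symm q.bypass).IsTrail := by
    rw [Walk.isTrail_cons, Sym2.eq_swap]
    exact ⟨q.bypass_isPath.isTrail, hb⟩
  have hw : ((walkWeight w (Walk.cons hab.symm q.bypass) : ℝ≥0) : ℝ) =
      w s(a, b) + walkWeight w q.bypass := by
    rw [walkWeight_cons, Sym2.eq_swap]; push_cast; rfl
  refine ⟨q.bypass, ?_, walkWeight_bypass_le w q, fun f hf => ?_, fun f hf => ?_⟩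
  · have := hH _ _ htr s(a, b) (by simp [Sym2.eq_swap])
    rw [hw] at this
    linarith
  · have := hH _ _ htr f (by simp [hf])
    rwa [hw] at this
  · by_cases hfb : f ∈ q.bypass.edges
    · exact Or.inl hfb
    · right
      have h1 : q.bypass.edges.Sublist (q.edges.erase f) := by
        have := q.edges_bypass_sublist_edges.erase f
        rwa [List.erase_of_not_mem hfb] at this
      have h2 := List.sum_map_erase w hf
      unfold walkWeight
      rw [← h2]
      gcongr
      exact (h1.map w).sum_le_sum (by simp)

/-- Let `A` be the set of vertices within `r` of `c` by walks avoiding `e = uv`. If `v ∈ A`, then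
`e` has a detour through `c` of length at most `2r`. Otherwise `p` leaves `A` by an edge `xy`, and a
path of length at most `r` from `c` to `y` must use `e`; replacing `e` by the way through `x` and
`xy` gives a detour of length at most `2r - w(e) + w(xy)`. This is too short for `e`, or, if `xy` is
heavier and lies on the detour, too short for `xy`. -/
theorem LongCircuits.false_of_walk (hδ : 0 ≤ δ) (hH : LongCircuits H w δ) {F : SimpleGraph V}
    (hFH : F ≤ H) {c : V} (hF : ∀ x y, F.Adj x y → Near H w r c x) {u v : V} (huv : F.Adj u v)
    (hr : 2 * r ≤ (1 + δ) * w s(u, v)) (p : F.Walk u v) (hp : s(u, v) ∉ p.edges)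
    (hu : ∃ q : H.Walk c u, s(u, v) ∉ q.edges ∧ (walkWeight w q : ℝ) ≤ r) : False := by
  set e := s(u, v) with he
  let A : Set V := {x | ∃ q : H.Walk c x, e ∉ q.edges ∧ (walkWeight w q : ℝ) ≤ r}
  by_cases hv : v ∈ A
  · obtain ⟨qu, hqu, hru⟩ := hu
    obtain ⟨qv, hqv, hrv⟩ := hv
    obtain ⟨q', h1, h2, -⟩ := hH.exists_detour (hFH huv) (qu.reverse.append qv)
      (by simp [hqu, hqv, ← he])
    have h3 : (walkWeight w q' : ℝ) ≤ walkWeight w qu + walkWeight w qv := by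
      exact_mod_cast h2.trans (by simp)
    linarith
  obtain ⟨x, y, hxy, p₁, p₂, rfl, hA, hy⟩ := exists_first_exit p A hu hv
  obtain ⟨qx, hqx, hrx⟩ := hA x (Walk.end_mem_support _)
  have hne : e ≠ s(x, y) := fun h => hp (by simp [h])
  obtain ⟨qy, hqy, hry⟩ := (hF y x hxy.symm).exists_isPath
  have hey : e ∈ qy.edges := by
    by_contra hcon
    exact hy ⟨qy, hcon, hry⟩
  obtain ⟨a, b, hab, q₁, q₂, rfl, heab⟩ := exists_eq_append_cons_of_mem_edges qy hey
  have hnd := hqy.isTrail.edges_nodup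
  rw [heab] at hne hqx hr
  simp only [Walk.edges_append, Walk.edges_cons, List.nodup_append, List.nodup_cons,
    List.mem_cons] at hnd
  have hn1 : s(a, b) ∉ q₁.edges := fun h => hnd.2.2 _ h _ (Or.inl rfl) rfl
  have hn2 := hnd.2.1.1
  have hwy : (walkWeight w q₁ : ℝ) + w s(a, b) + walkWeight w q₂ ≤ r := by
    refine le_trans (le_of_eq ?_) hry
    simp [add_assoc]
  obtain ⟨q', h1, h2, h3, h4⟩ := hH.exists_detour hab
    ((q₁.reverse.append qx).append (Walk.cons (hFH hxy) q₂.reverse))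
    (by simp [hn1, hn2, hqx, hne])
  have hwq : ((walkWeight w ((q₁.reverse.append qx).append
      (Walk.cons (hFH hxy) q₂.reverse)) : ℝ≥0) : ℝ) =
      walkWeight w q₁ + walkWeight w qx + (w s(x, y) + walkWeight w q₂) := by simp
  have h2' : (walkWeight w q' : ℝ) ≤
      walkWeight w q₁ + walkWeight w qx + (w s(x, y) + walkWeight w q₂) := by
    rw [← hwq]; exact_mod_cast h2
  by_cases hle : w s(x, y) ≤ w s(a, b)
  · have : (w s(x, y) : ℝ) ≤ w s(a, b) := by exact_mod_cast hle
    linarith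
  have hlt : (w s(a, b) : ℝ) < w s(x, y) := by exact_mod_cast not_le.1 hle
  rcases h4 s(x, y) (by simp) with h5 | h5
  · have h6 := h3 _ h5
    have h7 : (1 + δ) * w s(a, b) ≤ (1 + δ) * w s(x, y) := by gcongr
    linarith
  · have h6 : (w s(x, y) : ℝ) + walkWeight w q' ≤
        walkWeight w q₁ + walkWeight w qx + (w s(x, y) + walkWeight w q₂) := by
      rw [← hwq]; exact_mod_cast h5
    have h7 := (w s(a, b)).coe_nonneg
    linarith

/-- In a subgraph of a ball, each edge that is heavy relative to the radius is a bridge. -/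
theorem LongCircuits.isBridge (hδ : 0 ≤ δ) (hH : LongCircuits H w δ) {F : SimpleGraph V}
    (hFH : F ≤ H) {c : V} (hF : ∀ x y, F.Adj x y → Near H w r c x) {u v : V} (huv : F.Adj u v)
    (hr : 2 * r ≤ (1 + δ) * w s(u, v)) : F.IsBridge s(u, v) := by
  rw [isBridge_iff_forall_walk_mem_edges]
  intro p
  by_contra hp
  obtain ⟨q, hq, hqr⟩ := (hF u v huv).exists_isPath
  by_cases hmem : s(u, v) ∈ q.edges
  -- Cut before the edge, the path reaches one end of it without using it.
  · obtain ⟨a, b, hab, q₁, q₂, rfl, heab⟩ := exists_eq_append_cons_of_mem_edges q hmem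
    have hnd := hq.isTrail.edges_nodup
    simp only [Walk.edges_append, Walk.edges_cons, List.nodup_append, List.nodup_cons,
      List.mem_cons] at hnd
    have hn1 : s(u, v) ∉ q₁.edges := fun h => hnd.2.2 _ h _ (Or.inl rfl) heab
    have hw1 : (walkWeight w q₁ : ℝ) ≤ r := by
      refine le_trans ?_ hqr
      exact_mod_cast (by simp : walkWeight w q₁ ≤ walkWeight w (q₁.append (Walk.cons hab q₂)))
    rcases Sym2.eq_iff.1 heab with ⟨rfl, rfl⟩ | ⟨rfl, rfl⟩
    · exact hH.false_of_walk hδ hFH hF huv hr p hp ⟨q₁, hn1, hw1⟩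
    · rw [Sym2.eq_swap] at hr hp hn1
      exact hH.false_of_walk hδ hFH hF huv.symm hr p.reverse (by simpa using hp) ⟨q₁, hn1, hw1⟩
  · exact hH.false_of_walk hδ hFH hF huv hr p hp ⟨q, hmem, hqr⟩

/-- The isoperimetric inequality for the heavy edges: a nonnegative function `g` supported in a ball
of radius `r` has total variation on the tree `T` at least its total mass on the edges in `Q`,
which are heavy relative to `r`. -/
theorem LongCircuits.sum_inf_le [Fintype V] [DecidableEq V] (hδ : 0 ≤ δ)
    (hH : LongCircuits H w δ) {T Q : Finset (Sym2 V)}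
    (hT : (fromEdgeSet (T : Set (Sym2 V))).IsTree) (hTH : (T : Set (Sym2 V)) ⊆ H.edgeSet)
    (hQH : (Q : Set (Sym2 V)) ⊆ H.edgeSet) (hTQ : Disjoint T Q)
    (hQ : ∀ e ∈ Q, 2 * r ≤ (1 + δ) * w e) {c : V} {g : V → ℝ} (hg : ∀ v, 0 ≤ g v)
    (hgc : ∀ v, ¬ Near H w r c v → g v = 0) :
    ∑ e ∈ Q, (e.map g).inf ≤ ∑ e ∈ T, ((e.map g).sup - (e.map g).inf) := by
  classical
  set E := (T ∪ Q).filter fun e => ∀ x ∈ e, Near H w r c x with hE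
  set F := fromEdgeSet (E : Set (Sym2 V)) with hF
  have hsub : ((T ∪ Q : Finset (Sym2 V)) : Set (Sym2 V)) ⊆ H.edgeSet := by
    simpa using ⟨hTH, hQH⟩
  have hFH : F ≤ H := by
    rw [hF, ← fromEdgeSet_edgeSet H]
    exact fromEdgeSet_mono fun e he => hsub (Finset.mem_of_mem_filter e he)
  have hFadj : ∀ x y, F.Adj x y → s(x, y) ∈ E := fun x y h => h.1
  have hFnear : ∀ x y, F.Adj x y → Near H w r c x := fun x y h =>
    (Finset.mem_filter.1 (hFadj x y h)).2 x (Sym2.mem_mk_left _ _)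
  -- A cycle of `F` is not contained in `T`, so it has an edge in `Q`, which is a bridge.
  have hacyc : F.IsAcyclic := by
    intro v C hC
    by_cases hall : ∀ e ∈ C.edges, e ∈ T
    · have hall' : ∀ e ∈ C.edges, e ∈ (fromEdgeSet (T : Set (Sym2 V))).edgeSet := by
        intro e he
        rw [edgeSet_fromEdgeSet]
        exact ⟨hall e he, F.not_isDiag_of_mem_edgeSet (C.edges_subset_edgeSet he)⟩
      exact hT.isAcyclic _ (hC.transfer hall')
    · push Not at hall
      obtain ⟨e, he, heT⟩ := hall
      have heF := C.edges_subset_edgeSet he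
      have heQ : e ∈ Q := by
        induction e with
        | h a b =>
          have := Finset.mem_of_mem_filter _ (hFadj a b heF)
          simpa [heT] using this
      have hbr : F.IsBridge e := by
        have := hQ e heQ
        induction e with
        | h a b => exact hH.isBridge hδ hFH hFnear heF this
      exact (isBridge_iff_forall_cycle_notMem heF).1 hbr C hC he
  have hdiag : ∀ e ∈ H.edgeSet, ¬ e.IsDiag := fun e he => H.not_isDiag_of_mem_edgeSet he
  have key := sum_inf_le_sum_sup hacyc
    (fun e he => hdiag e (hsub (Finset.mem_of_mem_filter e he))) hT
    (fun e he => hdiag e (hTH he)) hg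
  -- `g` vanishes at an end of each discarded edge.
  have hEsum : ∑ e ∈ E, (e.map g).inf = ∑ e ∈ T ∪ Q, (e.map g).inf := by
    refine Finset.sum_subset (Finset.filter_subset _ _) fun e he heE => ?_
    have : ∃ x ∈ e, ¬ Near H w r c x := by
      by_contra hcon
      push Not at hcon
      exact heE (Finset.mem_filter.2 ⟨he, hcon⟩)
    obtain ⟨x, hx, hnx⟩ := this
    refine le_antisymm ?_ (inf_map_nonneg hg e)
    rw [← hgc x hnx]
    exact inf_map_le hx
  rw [hEsum, Finset.sum_union hTQ] at key
  rw [Finset.sum_sub_distrib]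
  linarith

end Near

/-! ### Integration over the radius. -/

section Integral

/-- The integral telescopes to that of `h` over `[b - ω, b + ω]` minus that over `[a - ω, a + ω]`.
-/
theorem integral_sub_shift_le {h : ℝ → ℝ} (hm : Monotone h) {B : ℝ} (h0 : ∀ x, 0 ≤ h x)
    (hB : ∀ x, h x ≤ B) (a b : ℝ) {ω : ℝ} (hω : 0 ≤ ω) :
    ∫ r in a..b, (h (r + ω) - h (r - ω)) ≤ 2 * ω * B := by
  have hi : ∀ c d, IntervalIntegrable h volume c d := fun c d => hm.intervalIntegrable
  have hi1 : IntervalIntegrable (fun r => h (r + ω)) volume a b :=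
    Monotone.intervalIntegrable fun x y hxy => hm (by linarith)
  have hi2 : IntervalIntegrable (fun r => h (r - ω)) volume a b :=
    Monotone.intervalIntegrable fun x y hxy => hm (by linarith)
  rw [intervalIntegral.integral_sub hi1 hi2, intervalIntegral.integral_comp_add_right,
    intervalIntegral.integral_comp_sub_right,
    intervalIntegral.integral_interval_sub_interval_comm (hi _ _) (hi _ _) (hi _ _),
    intervalIntegral.integral_symm (a - ω), intervalIntegral.integral_symm (b - ω)]
  have h1 : 0 ≤ ∫ x in (a - ω)..(a + ω), h x :=
    intervalIntegral.integral_nonneg (by linarith) fun x _ => h0 x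
  have h2 : ∫ x in (b - ω)..(b + ω), h x ≤ ∫ _ in (b - ω)..(b + ω), B :=
    intervalIntegral.integral_mono_on (by linarith) (hi _ _) (by simp) fun x _ => hB x
  rw [intervalIntegral.integral_const, smul_eq_mul] at h2
  linarith

/-- Integration over all radii of the isoperimetric inequality between heavy edges and a tree. -/
theorem sum_le_of_forall_radius {ι : Type*} {Q T : Finset ι} {ω : ι → ℝ} (hω : ∀ i, 0 ≤ ω i)
    {h : ι → ℝ → ℝ} (hm : ∀ i, Monotone (h i)) {B t : ℝ} (h0 : ∀ i x, 0 ≤ h i x)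
    (hB : ∀ i x, h i x ≤ B) (hBt : B ≤ t) (ht : 0 ≤ t)
    (hr : ∀ r, 0 < r →
      ∑ i ∈ Q, (Set.Ioc (t * ω i / 4) (t * ω i / 2)).indicator
          (fun r => Real.exp (-8) * (9 - (h i (r + ω i) - h i (r - ω i)))) r ≤
        ∑ i ∈ T, ((Set.Iic (ω i)).indicator (fun _ => 2) r +
          2 * (h i (r + ω i) - h i (r - ω i)))) :
    ∑ i ∈ Q, Real.exp (-8) * (t * ω i / 4) ≤ ∑ i ∈ T, (2 * ω i + 4 * (ω i * B)) := by
  -- Large enough for `(0, M]` to contain the windows of all `i ∈ Q`.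
  set M := ∑ i ∈ Q, t * ω i / 2 with hM
  have hM0 : 0 ≤ M := Finset.sum_nonneg fun i _ => by have := hω i; positivity
  have hle : ∀ i ∈ Q, t * ω i / 2 ≤ M := fun i hi =>
    Finset.single_le_sum (f := fun i => t * ω i / 2)
      (fun j _ => by have := hω j; positivity) hi
  have hint : ∀ i a b, IntervalIntegrable (fun r => h i (r + ω i) - h i (r - ω i)) volume a b :=
    fun i a b => IntervalIntegrable.sub
      (Monotone.intervalIntegrable fun x y hxy => hm i (by linarith))
      (Monotone.intervalIntegrable fun x y hxy => hm i (by linarith))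
  have hint' : ∀ i a b, a ≤ b →
      IntegrableOn (fun r => h i (r + ω i) - h i (r - ω i)) (Set.Ioc a b) volume :=
    fun i a b hab => (intervalIntegrable_iff_integrableOn_Ioc_of_le hab).1 (hint i a b)
  have hQint : ∀ i, IntegrableOn
      (fun r => Real.exp (-8) * (9 - (h i (r + ω i) - h i (r - ω i)))) (Set.Ioc 0 M) :=
    fun i => ((integrableOn_const (by simp)).sub (hint' i 0 M hM0)).const_mul _
  have hTint1 : ∀ i, IntegrableOn ((Set.Iic (ω i)).indicator (fun _ => (2 : ℝ))) (Set.Ioc 0 M) :=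
    fun i => (integrableOn_const (by simp)).indicator measurableSet_Iic
  have hTint2 : ∀ i, IntegrableOn (fun r => 2 * (h i (r + ω i) - h i (r - ω i)))
      (Set.Ioc 0 M) := fun i => (hint' i 0 M hM0).const_mul _
  have hTint : ∀ i, IntegrableOn (fun r => (Set.Iic (ω i)).indicator (fun _ => (2 : ℝ)) r +
      2 * (h i (r + ω i) - h i (r - ω i))) (Set.Ioc 0 M) := fun i => (hTint1 i).add (hTint2 i)
  have key : ∫ r in Set.Ioc 0 M, ∑ i ∈ Q, (Set.Ioc (t * ω i / 4) (t * ω i / 2)).indicator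
          (fun r => Real.exp (-8) * (9 - (h i (r + ω i) - h i (r - ω i)))) r ≤
      ∫ r in Set.Ioc 0 M, ∑ i ∈ T, ((Set.Iic (ω i)).indicator (fun _ => 2) r +
          2 * (h i (r + ω i) - h i (r - ω i))) := by
    refine setIntegral_mono_on ?_ ?_ measurableSet_Ioc fun r hr' => hr r hr'.1
    · exact integrable_finsetSum _ fun i _ => (hQint i).indicator measurableSet_Ioc
    · exact integrable_finsetSum _ fun i _ => hTint i
  rw [integral_finsetSum _ fun i _ => (hQint i).indicator measurableSet_Ioc,
    integral_finsetSum _ fun i _ => hTint i] at key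
  refine le_trans (Finset.sum_le_sum fun i hi => ?_)
    (key.trans (Finset.sum_le_sum fun i _ => ?_))
  · have hωi := hω i
    have h1 : 0 ≤ t * ω i := by positivity
    have hsub : Set.Ioc 0 M ∩ Set.Ioc (t * ω i / 4) (t * ω i / 2) =
        Set.Ioc (t * ω i / 4) (t * ω i / 2) :=
      Set.inter_eq_right.2 (Set.Ioc_subset_Ioc (by linarith) (hle i hi))
    have hab : t * ω i / 4 ≤ t * ω i / 2 := by linarith
    rw [setIntegral_indicator measurableSet_Ioc, hsub,
      ← intervalIntegral.integral_of_le hab, intervalIntegral.integral_const_mul,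
      intervalIntegral.integral_sub (by simp) (hint i _ _), intervalIntegral.integral_const,
      smul_eq_mul]
    -- The window has length `tω/4`, and `9tω/4 - 2ωB ≥ tω/4`.
    have h2 := integral_sub_shift_le (hm i) (h0 i) (hB i) (t * ω i / 4) (t * ω i / 2) hωi
    have h3 : ω i * B ≤ ω i * t := by gcongr
    gcongr
    linarith
  · have hωi := hω i
    rw [integral_add (hTint1 i) (hTint2 i), setIntegral_indicator measurableSet_Iic,
      integral_const_mul, ← intervalIntegral.integral_of_le hM0]
    have h2 := integral_sub_shift_le (hm i) (h0 i) (hB i) 0 M hωi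
    have h3 : ∫ _ in Set.Ioc 0 M ∩ Set.Iic (ω i), (2 : ℝ) ≤ 2 * ω i := by
      rw [setIntegral_const, smul_eq_mul, mul_comm]
      have : volume.real (Set.Ioc 0 M ∩ Set.Iic (ω i)) ≤ volume.real (Set.Ioc 0 (ω i)) :=
        measureReal_mono (fun x hx => ⟨hx.1.1, hx.2⟩) (by simp)
      rw [Real.volume_real_Ioc_of_le hωi] at this
      linarith
    linarith

end Integral

/-! ### Uniform distributions on balls, and the weight of graphs with long circuits. -/

section BallCard

variable {V : Type*} [Fintype V] {H : SimpleGraph V} {w : Sym2 V → ℝ≥0} {δ r : ℝ}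

open Classical in
/-- The number of vertices at distance at most `r` from `x`. -/
def ballCard (H : SimpleGraph V) (w : Sym2 V → ℝ≥0) (x : V) (r : ℝ) : ℕ :=
  (Finset.univ.filter fun y => Near H w r x y).card

theorem ballCard_mono (x : V) : Monotone (ballCard H w x) := by
  classical
  intro r r' hr
  exact Finset.card_le_card fun y hy => by
    simp only [Finset.mem_filter, Finset.mem_univ, true_and] at hy ⊢
    exact hy.mono hr

theorem ballCard_le (x : V) (r : ℝ) : ballCard H w x r ≤ Fintype.card V :=
  Finset.card_le_univ _

theorem ballCard_pos (x : V) (hr : 0 ≤ r) : 0 < ballCard H w x r :=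
  Finset.card_pos.2 ⟨x, by simpa using near_self hr x⟩

/-- For negative radii the ball is empty and `Real.log 0 = 0` keeps monotonicity. -/
theorem log_ballCard_mono (x : V) : Monotone fun r => Real.log (ballCard H w x r) := by
  intro r r' hr
  rcases Nat.eq_zero_or_pos (ballCard H w x r) with h | h
  · simp only [h, Nat.cast_zero, Real.log_zero]
    exact Real.log_natCast_nonneg _
  · exact Real.log_le_log (by exact_mod_cast h) (by exact_mod_cast ballCard_mono x hr)

theorem log_ballCard_le (x : V) (r : ℝ) :
    Real.log (ballCard H w x r) ≤ Real.log (Fintype.card V) := by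
  rcases Nat.eq_zero_or_pos (ballCard H w x r) with h | h
  · simp only [h, Nat.cast_zero, Real.log_zero]
    exact Real.log_natCast_nonneg _
  · exact Real.log_le_log (by exact_mod_cast h) (by exact_mod_cast ballCard_le x r)

open Classical in
/-- The share of `c` in the uniform distribution on the ball of radius `r` around `x`. -/
def ballShare (H : SimpleGraph V) (w : Sym2 V → ℝ≥0) (r : ℝ) (c x : V) : ℝ :=
  if Near H w r c x then (ballCard H w x r : ℝ)⁻¹ else 0

theorem ballShare_nonneg (c x : V) : 0 ≤ ballShare H w r c x := by
  unfold ballShare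
  split_ifs <;> positivity

theorem sum_ballShare (hr : 0 ≤ r) (x : V) : ∑ c, ballShare H w r c x = 1 := by
  classical
  have h : (Finset.univ.filter fun c => Near H w r c x) =
      Finset.univ.filter fun c => Near H w r x c :=
    Finset.filter_congr fun c _ => ⟨Near.symm, Near.symm⟩
  simp only [ballShare]
  rw [← Finset.sum_filter, Finset.sum_const, h, nsmul_eq_mul]
  have := ballCard_pos (H := H) (w := w) x hr
  exact mul_inv_cancel₀ (by exact_mod_cast this.ne')

/-- The overlap of the uniform distributions on the balls around the ends of an edge. -/
def overlap (H : SimpleGraph V) (w : Sym2 V → ℝ≥0) (r : ℝ) (e : Sym2 V) : ℝ :=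
  ∑ c, (e.map (ballShare H w r c)).inf

theorem overlap_nonneg (e : Sym2 V) : 0 ≤ overlap H w r e :=
  Finset.sum_nonneg fun c _ => inf_map_nonneg (ballShare_nonneg c) e

theorem sum_sup_sub_inf (hr : 0 ≤ r) (e : Sym2 V) :
    ∑ c, ((e.map (ballShare H w r c)).sup - (e.map (ballShare H w r c)).inf) =
      2 - 2 * overlap H w r e := by
  have h : ∑ c, ((e.map (ballShare H w r c)).sup + (e.map (ballShare H w r c)).inf) = 2 := by
    induction e with
    | h x y =>
      simp only [Sym2.map_mk, Sym2.sup_mk, Sym2.inf_mk]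
      have : ∀ c, ballShare H w r c x ⊔ ballShare H w r c y +
          ballShare H w r c x ⊓ ballShare H w r c y =
          ballShare H w r c x + ballShare H w r c y := fun c => max_add_min _ _
      simp only [this, Finset.sum_add_distrib, sum_ballShare hr]
      norm_num
  unfold overlap
  rw [Finset.sum_add_distrib] at h
  rw [Finset.sum_sub_distrib]
  linarith

/-- The ball of radius `r - ω` around `x` lies in the balls of radius `r` around `x` and `y`, and
both lie in that of radius `r + ω` around `x`. -/
theorem le_overlap (hr : 0 ≤ r) {x y : V} (hxy : H.Adj x y) :
    (ballCard H w x (r - w s(x, y)) : ℝ) / ballCard H w x (r + w s(x, y)) ≤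
      overlap H w r s(x, y) := by
  classical
  set ω := ((w s(x, y) : ℝ≥0) : ℝ) with hω
  have hω0 : 0 ≤ ω := NNReal.coe_nonneg _
  have hle1 : ballCard H w x r ≤ ballCard H w x (r + ω) := ballCard_mono x (by linarith)
  have hle2 : ballCard H w y r ≤ ballCard H w x (r + ω) := by
    refine Finset.card_le_card fun z hz => ?_
    simp only [Finset.mem_filter, Finset.mem_univ, true_and] at hz ⊢
    exact hz.of_adj hxy
  have hx := ballCard_pos (H := H) (w := w) x hr
  have hy := ballCard_pos (H := H) (w := w) y hr
  calc (ballCard H w x (r - ω) : ℝ) / ballCard H w x (r + ω)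
      = ∑ c ∈ Finset.univ.filter fun c => Near H w (r - ω) x c,
          (ballCard H w x (r + ω) : ℝ)⁻¹ := by
        rw [Finset.sum_const, nsmul_eq_mul, div_eq_mul_inv]; rfl
    _ ≤ ∑ c ∈ Finset.univ.filter fun c => Near H w (r - ω) x c,
          (s(x, y).map (ballShare H w r c)).inf := by
        refine Finset.sum_le_sum fun c hc => ?_
        simp only [Finset.mem_filter, Finset.mem_univ, true_and] at hc
        have h1 : Near H w r c x := (hc.mono (by linarith)).symm
        have h2 : Near H w r c y := by
          have := (hc.of_adj hxy.symm).symm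
          rwa [Sym2.eq_swap, ← hω, sub_add_cancel] at this
        simp only [Sym2.map_mk, Sym2.inf_mk, ballShare, h1, h2, if_true]
        refine le_inf ?_ ?_
        · gcongr
        · gcongr
    _ ≤ overlap H w r s(x, y) :=
        Finset.sum_le_sum_of_subset_of_nonneg (Finset.subset_univ _) fun c _ _ =>
          inf_map_nonneg (ballShare_nonneg c) _

theorem exp_le_overlap {e : Sym2 V} (he : e ∈ H.edgeSet) {x : V} (hx : x ∈ e) (hr : w e ≤ r) :
    Real.exp (-(Real.log (ballCard H w x (r + w e)) - Real.log (ballCard H w x (r - w e)))) ≤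
      overlap H w r e := by
  obtain ⟨y, rfl⟩ := hx
  have hr0 : 0 ≤ r := le_trans (NNReal.coe_nonneg _) hr
  refine le_trans (le_of_eq ?_) (le_overlap hr0 he)
  rw [neg_sub, Real.exp_sub, Real.exp_log, Real.exp_log]
  · exact_mod_cast ballCard_pos x (by positivity)
  · exact_mod_cast ballCard_pos x (by linarith)

/-- A graph with long circuits is light: the weight of the edges outside a spanning tree `T` is at
most a constant times that of `T`, if the circuits are longer than `log n` times their edges. -/
theorem LongCircuits.sum_le [DecidableEq V] (hδ : Real.log (Fintype.card V) ≤ δ)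
    (hδ3 : 3 ≤ δ) (hH : LongCircuits H w δ) {T Q : Finset (Sym2 V)}
    (hT : (fromEdgeSet (T : Set (Sym2 V))).IsTree) (hTH : (T : Set (Sym2 V)) ⊆ H.edgeSet)
    (hQH : (Q : Set (Sym2 V)) ⊆ H.edgeSet) (hTQ : Disjoint T Q) :
    ∑ e ∈ Q, (w e : ℝ) ≤ 16 * Real.exp 8 * ∑ e ∈ T, (w e : ℝ) := by
  classical
  have hδ0 : 0 ≤ δ := by linarith
  set B := Real.log (Fintype.card V) with hB
  -- Either end would do, since `exp_le_overlap` holds for both.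
  let base : Sym2 V → V := fun e => e.out.1
  have hbase : ∀ e, base e ∈ e := fun e => Sym2.out_fst_mem e
  have key := sum_le_of_forall_radius (Q := Q) (T := T) (ω := fun e => (w e : ℝ))
    (fun e => NNReal.coe_nonneg _) (h := fun e r => Real.log (ballCard H w (base e) r))
    (fun e => log_ballCard_mono _) (B := B) (t := 1 + δ)
    (fun e r => Real.log_natCast_nonneg _) (fun e r => log_ballCard_le _ _)
    (by linarith) (by linarith) ?_
  · rw [← Finset.mul_sum] at key
    have h1 : ∑ e ∈ Q, (1 + δ) * (w e : ℝ) / 4 = (1 + δ) / 4 * ∑ e ∈ Q, (w e : ℝ) := by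
      rw [Finset.mul_sum]; exact Finset.sum_congr rfl fun e _ => by ring
    have h2 : ∑ e ∈ T, (2 * (w e : ℝ) + 4 * (w e * B)) = (2 + 4 * B) * ∑ e ∈ T, (w e : ℝ) := by
      rw [Finset.mul_sum]; exact Finset.sum_congr rfl fun e _ => by ring
    rw [h1, h2] at key
    set A := ∑ e ∈ Q, (w e : ℝ)
    set L := ∑ e ∈ T, (w e : ℝ) with hL
    have hL0 : 0 ≤ L := Finset.sum_nonneg fun e _ => NNReal.coe_nonneg _
    have h3 : (2 + 4 * B) * L ≤ (4 * (1 + δ)) * L := by gcongr; linarith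
    have h4 : Real.exp (-8) * Real.exp 8 = 1 := by rw [← Real.exp_add]; simp
    have h5 : (1 + δ) * (Real.exp (-8) * A) ≤ (1 + δ) * (16 * L) := by linarith
    have h6 : Real.exp (-8) * A ≤ 16 * L := le_of_mul_le_mul_left h5 (by linarith)
    calc A = Real.exp 8 * (Real.exp (-8) * A) := by rw [← mul_assoc, mul_comm (Real.exp 8), h4, one_mul]
      _ ≤ Real.exp 8 * (16 * L) := by gcongr
      _ = _ := by ring
  intro r hr
  -- The isoperimetric inequality for `ballShare H w r c`, summed over all centres `c`.
  have hiso : ∑ e ∈ Q.filter fun e => 2 * r ≤ (1 + δ) * w e, overlap H w r e ≤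
      ∑ e ∈ T, (2 - 2 * overlap H w r e) := by
    simp only [← sum_sup_sub_inf hr.le]
    unfold overlap
    rw [Finset.sum_comm, Finset.sum_comm (s := T)]
    refine Finset.sum_le_sum fun c _ => ?_
    refine hH.sum_inf_le hδ0 hT hTH (r := r) (c := c)
      (fun e he => hQH (Finset.mem_of_mem_filter e he))
      (hTQ.mono_right (Finset.filter_subset _ _)) (fun e he => (Finset.mem_filter.1 he).2)
      (ballShare_nonneg c) fun v hv => ?_
    simp [ballShare, hv]
  refine le_trans ?_ (hiso.trans ?_)
  · rw [Finset.sum_filter]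
    refine Finset.sum_le_sum fun e he => ?_
    have hw0 := (w e).coe_nonneg
    by_cases hmem : r ∈ Set.Ioc ((1 + δ) * (w e : ℝ) / 4) ((1 + δ) * (w e : ℝ) / 2)
    · rw [Set.indicator_of_mem hmem, if_pos (by linarith [hmem.2])]
      -- Here `3 ≤ δ` enters, as `(1 + δ) / 4 ≥ 1`.
      have hwr : (w e : ℝ) ≤ r := by nlinarith [hmem.1]
      refine le_trans ?_ (exp_le_overlap (hQH he) (hbase e) hwr)
      set D := Real.log (ballCard H w (base e) (r + w e)) -
        Real.log (ballCard H w (base e) (r - w e))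
      -- The tangent of `exp` at `-8` turns the bound into one linear in `D`, ready for integration.
      have h1 : Real.exp (-D) = Real.exp (-8) * Real.exp (8 - D) := by
        rw [← Real.exp_add]; congr 1; ring
      rw [h1]
      gcongr
      linarith [Real.add_one_le_exp (8 - D)]
    · rw [Set.indicator_of_notMem hmem]
      split_ifs
      · exact overlap_nonneg e
      · exact le_rfl
  · refine Finset.sum_le_sum fun e he => ?_
    have hw0 := (w e).coe_nonneg
    set D := Real.log (ballCard H w (base e) (r + w e)) -
        Real.log (ballCard H w (base e) (r - w e)) with hD
    have hD0 : 0 ≤ D := sub_nonneg.2 (log_ballCard_mono (H := H) (w := w) (base e) (by linarith))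
    -- For small radii the trivial bound `2` is used, which integrates to `2 w(e)`.
    by_cases hwr : r ≤ w e
    · rw [Set.indicator_of_mem (by simpa using hwr)]
      linarith [overlap_nonneg (H := H) (w := w) (r := r) e]
    · rw [Set.indicator_of_notMem (by simpa using hwr)]
      have h1 := exp_le_overlap (w := w) (hTH he) (hbase e) (not_le.1 hwr).le
      rw [← hD] at h1
      linarith [Real.add_one_le_exp (-D)]

end BallCard

/-! ### Conclusion. -/

section Main

variable {V : Type*} {H : SimpleGraph V} {w : Sym2 V → ℝ≥0} {δ : ℝ}

/-- The path in `T` between the ends of `e` is a detour. This crude bound serves for bounded `n`. -/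
theorem LongCircuits.weight_le_sum [DecidableEq V] (hδ : 0 ≤ δ) (hH : LongCircuits H w δ)
    {T : Finset (Sym2 V)} (hT : (fromEdgeSet (T : Set (Sym2 V))).Connected)
    (hTH : (T : Set (Sym2 V)) ⊆ H.edgeSet) {e : Sym2 V} (he : e ∈ H.edgeSet) (heT : e ∉ T) :
    w e ≤ ∑ f ∈ T, w f := by
  induction e with
  | h a b =>
    have hle : fromEdgeSet (T : Set (Sym2 V)) ≤ H := by
      rw [← fromEdgeSet_edgeSet H]; exact fromEdgeSet_mono hTH
    obtain ⟨p, hp⟩ := hT.exists_isPath a b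
    have hpT : ∀ f ∈ p.edges, f ∈ T := fun f hf => by
      have := p.edges_subset_edgeSet hf
      rw [edgeSet_fromEdgeSet] at this
      exact this.1
    obtain ⟨q, h1, h2, -⟩ := hH.exists_detour he (p.mapLe hle)
      (by simpa using fun h => heT (hpT _ h))
    have h3 : walkWeight w p ≤ ∑ f ∈ T, w f := by
      rw [walkWeight_eq_sum_of_nodup w p hp.isTrail.edges_nodup]
      exact Finset.sum_le_sum_of_subset fun f hf => hpT f (by simpa using hf)
    rw [walkWeight_mapLe] at h2
    have h4 : (walkWeight w q : ℝ) ≤ ∑ f ∈ T, w f := by exact_mod_cast h2.trans h3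
    have h5 : 0 ≤ δ * w s(a, b) := by positivity
    have h6 : (w s(a, b) : ℝ) ≤ ∑ f ∈ T, w f := by linarith
    exact_mod_cast h6

variable {G : SimpleGraph V} {s : V}

/-- The edges explored by `Blocking_δ` with `δ = log n` have total weight `O(opt)`. -/
theorem Trace.sum_weight_le [Fintype V] (hG : G.Connected)
    {h : List V} {es : List (V × V)} (ht : Trace G w (Real.log (Fintype.card V)) s h es)
    (hne : ∃ (s : V) (W : G.Walk s s), ∀ x, x ∈ W.support) :
    (es.map fun e => (w s(e.1, e.2) : ℝ)).sum ≤ (1 + 16 * Real.exp 8) * opt G w := by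
  classical
  set δ := Real.log (Fintype.card V) with hδ
  have hδ0 : 0 ≤ δ := Real.log_natCast_nonneg _
  set P := (es.map fun e => s(e.1, e.2)).toFinset with hP
  obtain ⟨T, hT⟩ := exists_isLightSpanning hG w P
  set H := fromEdgeSet ((T ∪ P : Finset (Sym2 V)) : Set (Sym2 V)) with hH
  have hlong : LongCircuits H w δ := fun x C hC f hf =>
    ht.lt_walkWeight_of_isTrail hδ0 hP hT hH C hC hf
  have hmem : ∀ e ∈ T ∪ P, e ∈ H.edgeSet := by
    intro e he
    rw [hH, edgeSet_fromEdgeSet]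
    refine ⟨he, G.not_isDiag_of_mem_edgeSet ?_⟩
    rcases Finset.mem_union.1 he with he | he
    · exact hT.subset he
    · exact ht.edges_subset he
  have hTH : (T : Set (Sym2 V)) ⊆ H.edgeSet := fun e he => hmem e (Finset.mem_union_left _ he)
  have hQH : ((P \ T : Finset (Sym2 V)) : Set (Sym2 V)) ⊆ H.edgeSet := fun e he =>
    hmem e (Finset.mem_union_right _ (Finset.mem_sdiff.1 he).1)
  have hopt : ∑ e ∈ T, (w e : ℝ) ≤ opt G w := by exact_mod_cast hT.sum_le_opt hne
  have hL0 : 0 ≤ ∑ e ∈ T, (w e : ℝ) := Finset.sum_nonneg fun e _ => NNReal.coe_nonneg _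
  have hQ : ∑ e ∈ P \ T, (w e : ℝ) ≤ 16 * Real.exp 8 * ∑ e ∈ T, (w e : ℝ) := by
    -- If `δ < 3`, there are fewer than `n < exp 3` edges to bound, each of weight at most `w(T)`.
    rcases le_or_gt 3 δ with h3 | h3
    · exact hlong.sum_le le_rfl h3 hT.isTree hTH hQH Finset.disjoint_sdiff
    · have h4 : ∑ e ∈ P \ T, (w e : ℝ) ≤ (P \ T).card • ∑ e ∈ T, (w e : ℝ) := by
        refine Finset.sum_le_card_nsmul _ _ _ fun e he => ?_
        exact_mod_cast hlong.weight_le_sum hδ0 hT.connected hTH (hQH he) (Finset.mem_sdiff.1 he).2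
      have h5 : (P \ T).card ≤ Fintype.card V := by
        refine (Finset.card_le_card Finset.sdiff_subset).trans ((List.toFinset_card_le _).trans ?_)
        have h6 := ht.nodup.length_le_card
        rw [ht.length_eq] at h6
        rw [List.length_map]
        omega
      have hn : (0 : ℝ) < Fintype.card V := by
        exact_mod_cast Fintype.card_pos_iff.2 ⟨s⟩
      have h6 : (Fintype.card V : ℝ) ≤ Real.exp 8 := by
        rw [← Real.exp_log hn]
        exact Real.exp_le_exp.2 (by linarith)
      have h7 : ((P \ T).card : ℝ) ≤ 16 * Real.exp 8 := by
        have : ((P \ T).card : ℝ) ≤ Fintype.card V := by exact_mod_cast h5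
        linarith [Real.exp_pos 8]
      rw [nsmul_eq_mul] at h4
      exact h4.trans (by gcongr)
  have hsum : (es.map fun e => (w s(e.1, e.2) : ℝ)).sum = ∑ e ∈ P, (w e : ℝ) := by
    rw [hP, List.sum_toFinset _ ht.nodup_edges, List.map_map]
    rfl
  have hsplit : ∑ e ∈ P, (w e : ℝ) ≤ ∑ e ∈ P \ T, (w e : ℝ) + ∑ e ∈ T, (w e : ℝ) := by
    rw [← Finset.sum_union Finset.sdiff_disjoint]
    exact Finset.sum_le_sum_of_subset_of_nonneg (by simp) fun e _ _ => NNReal.coe_nonneg _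
  rw [hsum]
  calc _ ≤ (1 + 16 * Real.exp 8) * ∑ e ∈ T, (w e : ℝ) := by linarith
    _ ≤ _ := by gcongr

theorem sum_weight_nonneg (w : Sym2 V → ℝ≥0) (es : List (V × V)) :
    0 ≤ (es.map fun e => (w s(e.1, e.2) : ℝ)).sum := by
  refine List.sum_nonneg fun x hx => ?_
  obtain ⟨e, -, rfl⟩ := List.mem_map.1 hx
  exact NNReal.coe_nonneg _

theorem sum_ofReal_eq (K : ℝ) (hK : 0 ≤ K) (es : List (V × V)) :
    (es.map fun e => ENNReal.ofReal (K * w s(e.1, e.2))).sum =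
      ENNReal.ofReal (K * (es.map fun e => (w s(e.1, e.2) : ℝ)).sum) := by
  induction es with
  | nil => simp
  | cons e es ih =>
    have h0 := sum_weight_nonneg w es
    rw [List.map_cons, List.sum_cons, ih, List.map_cons, List.sum_cons, mul_add,
      ENNReal.ofReal_add (by positivity) (by positivity)]

theorem blockingIsCompetitive_log [Fintype V] (hG : G.Connected) (w : Sym2 V → ℝ≥0) :
    BlockingIsCompetitive G w (Real.log (Fintype.card V))
      (10 * (1 + 16 * Real.exp 8) * Real.log (Fintype.card V)) := by
  intro s
  refine ⟨acc_step _, fun c hc hfin => ?_⟩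
  set δ := Real.log (Fintype.card V) with hδ
  have hδ0 : 0 ≤ δ := Real.log_natCast_nonneg _
  obtain ⟨es, hinv⟩ := RunInvariant.of_reachable hδ0 hc
  obtain ⟨hpos, hall⟩ := hinv.of_final hG hfin
  have hsupp : ∀ x, x ∈ c.walk.support := fun x => hinv.hist_subset (hall x)
  refine ⟨hpos, hsupp, ?_⟩
  have hne : ∃ (s : V) (W : G.Walk s s), ∀ x, x ∈ W.support :=
    ⟨s, c.walk.copy rfl hpos, by simpa using hsupp⟩
  have hcost : (walkWeight w c.walk : ℝ) ≤
      2 * (2 + δ) * (es.map fun e => (w s(e.1, e.2) : ℝ)).sum := by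
    have h1 := le_self_add.trans hinv.cost
    rw [sum_ofReal_eq _ (by positivity), ← ENNReal.ofReal_coe_nnreal] at h1
    refine (ENNReal.ofReal_le_ofReal_iff ?_).1 h1
    have := sum_weight_nonneg w es
    positivity
  have hsum := hinv.trace.sum_weight_le hG hne
  have hexp := Real.exp_pos 8
  -- If no edge was explored, the cost is zero. Otherwise `n ≥ 2`, so `δ ≥ log 2 > 1/2` and `2(2 +
  -- δ) ≤ 10δ`.
  rcases es.eq_nil_or_concat with rfl | hes
  · refine hcost.trans ?_
    simp only [List.map_nil, List.sum_nil, mul_zero]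
    positivity
  · have hlen := hinv.trace.nodup.length_le_card
    have h2 : 2 ≤ Fintype.card V := by
      obtain ⟨l, a, rfl⟩ := hes
      rw [hinv.trace.length_eq] at hlen
      simp at hlen
      omega
    have h3 : 1 / 2 ≤ δ := by
      have h4 : Real.log 2 ≤ δ := Real.log_le_log (by norm_num) (by exact_mod_cast h2)
      linarith [Real.log_two_gt_d9]
    calc (walkWeight w c.walk : ℝ) ≤ _ := hcost
      _ ≤ (10 * δ) * ((1 + 16 * Real.exp 8) * opt G w) := by
          exact mul_le_mul (by linarith) hsum (sum_weight_nonneg w es) (by positivity)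
      _ = _ := by ring

end Main

end OnlineExploration

end

theorem theorem2 :
    ∃ C : ℝ, ∀ (V : Type*) [Fintype V] (G : SimpleGraph V) (w : Sym2 V → NNReal),
      G.Connected →
        OnlineExploration.BlockingIsCompetitive G w
          (Real.log (Fintype.card V)) (C * Real.log (Fintype.card V)) :=
  ⟨10 * (1 + 16 * Real.exp 8), fun _ _ _ w hG =>
    OnlineExploration.blockingIsCompetitive_log hG w⟩
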